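/- Let $n\ge 0$ be an integer and let $\mathbb F=\mathbb R$, $\mathbb C$ or $\mathbb H$. Write $*$ for the conjugate transpose on $\mathbb F^{n\times n}$, let $U(n,\mathbb F)=\{A\in\mathbb F^{n\times n}: A^*A=AA^*=I_n\}$, and let $U(n,\mathbb F)^{\mathbb C}$ be its complexification, i.e. the group of all $g=a+ib\in\mathbb F^{n\times n}\otimes_{\mathbb R}\mathbb C$ (with $a,b\in\mathbb F^{n\times n}$) such that $g^*g=gg^*=1$, where $(a+ib)^*=a^*+ib^*$; it contains $U(n,\mathbb F)$ as the subgroup $b=0$. Let $$U^+(n,\mathbb F)=\{A\in U(n,\mathbb F):\ \operatorname{Re}\mu>0\text{ for every eigenvalue }\mu\text{ of }A\},$$ where eigenvalues are the complex eigenvalues (for $\mathbb F=\mathbb H$, those of the underlying $\mathbb C$-linear map of the right vector space $\mathbb H^n$). Then $U^+(n,\mathbb F)$ is open in $U(n,\mathbb F)$ and the quotient $U(n,\mathbb F)^{\mathbb C}/U(n,\mathbb F)$ is naturally identified with $U^+(n,\mathbb F)$, in the following sense. For $g=a+ib\in U(n,\mathbb F)^{\mathbb C}$ and $A\in U^+(n,\mathbb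 F)$ the matrix $bA+a$ is invertible, and $$g\cdot A=(aA-b)(bA+a)^{-1}$$ defines a smooth action of $U(n,\mathbb F)^{\mathbb C}$ on $U^+(n,\mathbb F)$. The map $g\mapsto g\cdot I_n$ induces a $U(n,\mathbb F)^{\mathbb C}$-equivariant homeomorphism $U(n,\mathbb F)^{\mathbb C}/U(n,\mathbb F)\to U^+(n,\mathbb F)$, and $g\mapsto g\cdot I_n$ has smooth local sections near every point of $U^+(n,\mathbb F)$, so that the homeomorphism is a diffeomorphism. Moreover, the complexified groups are the classical ones: $a+ib\mapsto a+ib$ is an isomorphism of topological groups from $U(n,\mathbb R)^{\mathbb C}$ onto $O(n,\mathbb C)$ and from $U(n,\mathbb C)^{\mathbb C}$ onto $GL(n,\mathbb C)$ (where in the second case $a+ib$ is evaluated in $\mathbb C^{n\times n}$), and $a+ib\mapsto\iota(a)+i\,\iota(b)$ is one from $U(n,\mathbb H)^{\mathbb C}$ onto $Sp(2n,\mathbb C)$, where $\iota(z+wj)=\begin{pmatrix}z&w\\-\bar w&\bar z\end{pmatrix}$ for $z,w\in\mathbb C^{n\times n}$. -/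

import Mathlib

open scoped Matrix Quaternion ContDiff

noncomputable section

/-! ### The complexification of a real star-algebra -/

/-- The complexification `A ⊗ ℂ` of a (real) algebra `A`, with elements written `re + i im`, where
`re, im ∈ A` and `i` is a new central square root of `-1` (not to be confused with a square root of
`-1` that may already be present in `A`). -/
@[ext]
structure Complexified (A : Type*) where
  re : A
  im : A

namespace Complexified

variable {A : Type*}

/-- The topology of `A × A`. -/
instance [TopologicalSpace A] : TopologicalSpace (Complexified A) :=
  TopologicalSpace.induced (fun z => (z.re, z.im)) inferInstance

variable [Ring A]

instance : Zero (Complexified A) := ⟨⟨0, 0⟩⟩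
instance : One (Complexified A) := ⟨⟨1, 0⟩⟩
instance : Add (Complexified A) := ⟨fun z w => ⟨z.re + w.re, z.im + w.im⟩⟩
instance : Neg (Complexified A) := ⟨fun z => ⟨-z.re, -z.im⟩⟩
instance : Mul (Complexified A) :=
  ⟨fun z w => ⟨z.re * w.re - z.im * w.im, z.re * w.im + z.im * w.re⟩⟩

@[simp] theorem zero_re : (0 : Complexified A).re = 0 := rfl
@[simp] theorem zero_im : (0 : Complexified A).im = 0 := rfl
@[simp] theorem one_re : (1 : Complexified A).re = 1 := rfl
@[simp] theorem one_im : (1 : Complexified A).im = 0 := rfl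
@[simp] theorem add_re (z w : Complexified A) : (z + w).re = z.re + w.re := rfl
@[simp] theorem add_im (z w : Complexified A) : (z + w).im = z.im + w.im := rfl
@[simp] theorem neg_re (z : Complexified A) : (-z).re = -z.re := rfl
@[simp] theorem neg_im (z : Complexified A) : (-z).im = -z.im := rfl
@[simp] theorem mul_re (z w : Complexified A) :
    (z * w).re = z.re * w.re - z.im * w.im := rfl
@[simp] theorem mul_im (z w : Complexified A) :
    (z * w).im = z.re * w.im + z.im * w.re := rfl

instance : Ring (Complexified A) where
  add_assoc x y z := by ext <;> simp [add_assoc]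
  zero_add x := by ext <;> simp
  add_zero x := by ext <;> simp
  add_comm x y := by ext <;> simp [add_comm]
  left_distrib x y z := by ext <;> simp <;> noncomm_ring
  right_distrib x y z := by ext <;> simp <;> noncomm_ring
  zero_mul x := by ext <;> simp
  mul_zero x := by ext <;> simp
  mul_assoc x y z := by ext <;> simp <;> noncomm_ring
  one_mul x := by ext <;> simp
  mul_one x := by ext <;> simp
  neg_add_cancel x := by ext <;> simp
  nsmul := nsmulRec
  zsmul := zsmulRec

variable [StarRing A]

/-- The complex *linear* extension `(a + i b)^* = a^* + i b^*` of the involution of `A`. -/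
instance : Star (Complexified A) := ⟨fun z => ⟨star z.re, star z.im⟩⟩

@[simp] theorem star_re (z : Complexified A) : (star z).re = star z.re := rfl
@[simp] theorem star_im (z : Complexified A) : (star z).im = star z.im := rfl

instance : StarRing (Complexified A) where
  star_involutive z := by ext <;> simp
  star_mul z w := by ext <;> simp [add_comm]
  star_add z w := by ext <;> simp

/-- The inclusion `a ↦ a + i 0` of `A` into its complexification. -/
def incl : A →⋆* Complexified A where
  toFun a := ⟨a, 0⟩
  map_one' := rfl
  map_mul' a b := by ext <;> simp
  map_star' a := by ext <;> simp

end Complexified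

/-! ### Unitary groups over `𝔽 = ℝ, ℂ, ℍ` and their complexifications -/

section UnitaryGroups

variable (F : Type*) [NormedDivisionRing F] [StarRing F] (n : ℕ)

/-- `U(n, 𝔽)`: the matrices `A` with `A^* A = A A^* = 1`, where `*` is the conjugate transpose. -/
abbrev UnitaryGp : Submonoid (Matrix (Fin n) (Fin n) F) :=
  unitary (Matrix (Fin n) (Fin n) F)

/-- `U(n, 𝔽)^ℂ`, the complex points of the real algebraic group `U(n, 𝔽)`: the elements
`g = a + i b`, with `a, b ∈ 𝔽^{n × n}`, that satisfy the equations `g^* g = g g^* = 1`, where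
`g^* = a^* + i b^*`. -/
abbrev UnitaryGpC : Submonoid (Complexified (Matrix (Fin n) (Fin n) F)) :=
  unitary (Complexified (Matrix (Fin n) (Fin n) F))

/-- `U(n, 𝔽)` as a subgroup of `U(n, 𝔽)^ℂ`: the image of `a ↦ a + i 0`. -/
def realForm : Subgroup (UnitaryGpC F n) :=
  MonoidHom.range
    (Unitary.map (Complexified.incl (A := Matrix (Fin n) (Fin n) F))).toMonoidHom

variable {F n}

/-- The unitary matrices all of whose eigenvalues have positive real part; `eig A` is the set of
complex eigenvalues of `A`. -/
def smallRotations (eig : Matrix (Fin n) (Fin n) F → Set ℂ) : Set (Matrix (Fin n) (Fin n) F) :=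
  {A | A ∈ UnitaryGp F n ∧ ∀ μ ∈ eig A, 0 < μ.re}

/-- The Möbius transformation `A ↦ (a A - b) (b A + a)⁻¹` given by `g = a + i b`. The block matrix
with rows `(a, -b)` and `(b, a)` maps the graph `{(A x, x)}` onto the graph of the transform. -/
def moebius (g : Complexified (Matrix (Fin n) (Fin n) F)) (A : Matrix (Fin n) (Fin n) F) :
    Matrix (Fin n) (Fin n) F :=
  (g.re * A - g.im) * Ring.inverse (g.im * A + g.re)

end UnitaryGroups

/-! ### Complex eigenvalues -/

section Eigenvalues

variable {n : ℕ}

/-- The eigenvalues of a complex matrix. -/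
def eigenvaluesComplex (A : Matrix (Fin n) (Fin n) ℂ) : Set ℂ :=
  {μ | ∃ v : Fin n → ℂ, v ≠ 0 ∧ A *ᵥ v = μ • v}

/-- The (complex) eigenvalues of a real matrix. -/
def eigenvaluesReal (A : Matrix (Fin n) (Fin n) ℝ) : Set ℂ :=
  eigenvaluesComplex (A.map (fun r : ℝ => (r : ℂ)))

/-- The eigenvalues of the `ℂ`-linear map underlying a quaternionic matrix `A`, which acts on the
right vector space `ℍⁿ`: the numbers `μ ∈ ℂ ⊆ ℍ` with `A v = v μ` for some `v ≠ 0`. -/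
def eigenvaluesQuaternion (A : Matrix (Fin n) (Fin n) ℍ) : Set ℂ :=
  {μ | ∃ v : Fin n → ℍ, v ≠ 0 ∧ A *ᵥ v = fun k => v k * (μ : ℍ)}

end Eigenvalues

/-! ### The classical groups -/

section Classical

variable {n : ℕ}

/-- `a + i b ↦ a + i b`, from the complexification of the real matrices to the complex ones. -/
def realToClassical (g : Complexified (Matrix (Fin n) (Fin n) ℝ)) : Matrix (Fin n) (Fin n) ℂ :=
  g.re.map (fun r : ℝ => (r : ℂ)) + Complex.I • g.im.map (fun r : ℝ => (r : ℂ))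

/-- `a + i b ↦ a + i b`, evaluated in the complex matrices. -/
def complexToClassical (g : Complexified (Matrix (Fin n) (Fin n) ℂ)) :
    Matrix (Fin n) (Fin n) ℂ :=
  g.re + Complex.I • g.im

/-- The standard embedding of quaternionic into complex matrices: the matrix `z + w j`, with
`z, w` complex, is sent to the block matrix with rows `(z, w)` and `(-conj w, conj z)`. -/
def quaternionEmbedding (a : Matrix (Fin n) (Fin n) ℍ) :
    Matrix (Fin n ⊕ Fin n) (Fin n ⊕ Fin n) ℂ :=
  Matrix.fromBlocks
    (a.map fun q : ℍ => (⟨q.re, q.imI⟩ : ℂ)) (a.map fun q : ℍ => (⟨q.imJ, q.imK⟩ : ℂ))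
    (a.map fun q : ℍ => -(⟨q.imJ, -q.imK⟩ : ℂ)) (a.map fun q : ℍ => (⟨q.re, -q.imI⟩ : ℂ))

/-- `a + i b ↦ ι a + i ι b`, with `ι` the standard embedding of quaternionic into complex
matrices. -/
def quaternionToClassical (g : Complexified (Matrix (Fin n) (Fin n) ℍ)) :
    Matrix (Fin n ⊕ Fin n) (Fin n ⊕ Fin n) ℂ :=
  quaternionEmbedding g.re + Complex.I • quaternionEmbedding g.im

end Classical

/-! ### The identification -/

section Identification

attribute [local instance] Matrix.normedAddCommGroup Matrix.normedSpace

/-- `U(n, 𝔽)^ℂ / U(n, 𝔽)` is naturally identified with the set `S` of unitary matrices: `S` is open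
in `U(n, 𝔽)`, Möbius transformations define an action of `U(n, 𝔽)^ℂ` on `S`, and the orbit map
`g ↦ g · 1` at the identity matrix descends to a homeomorphism `Φ` from the quotient onto `S`,
equivariant for `U(n, 𝔽)^ℂ`. The last two conditions say that the action is smooth, and that the
orbit map has smooth local sections, so `Φ` is a diffeomorphism for the smooth structure of the
quotient (the one for which the projection is a submersion). For functions on the embedded
submanifolds `U(n, 𝔽)^ℂ` and `S` of vector spaces, `ContDiffOn ℝ ∞` is the usual smoothness. -/
def NaturallyIdentified (F : Type*) [NormedDivisionRing F] [StarRing F] [NormedAlgebra ℝ F]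
    (n : ℕ) (S : Set (Matrix (Fin n) (Fin n) F)) : Prop :=
  (∃ V : Set (Matrix (Fin n) (Fin n) F), IsOpen V ∧ S = V ∩ UnitaryGp F n) ∧
  (∃ (_ : MulAction (UnitaryGpC F n) S) (Φ : (UnitaryGpC F n ⧸ realForm F n) ≃ₜ S),
    (∀ (g : UnitaryGpC F n) (A : S),
      IsUnit (g.1.im * A.1 + g.1.re) ∧ ((g • A : S) : Matrix (Fin n) (Fin n) F) =
        moebius g.1 A.1) ∧
    (∀ g : UnitaryGpC F n, (Φ (QuotientGroup.mk g) : Matrix (Fin n) (Fin n) F) =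
      moebius g.1 1) ∧
    (∀ (g : UnitaryGpC F n) (x : UnitaryGpC F n ⧸ realForm F n), Φ (g • x) = g • Φ x)) ∧
  ContDiffOn ℝ ∞
    (fun p : (Matrix (Fin n) (Fin n) F × Matrix (Fin n) (Fin n) F) × Matrix (Fin n) (Fin n) F =>
      moebius ⟨p.1.1, p.1.2⟩ p.2)
    {p | (⟨p.1.1, p.1.2⟩ : Complexified (Matrix (Fin n) (Fin n) F)) ∈ UnitaryGpC F n ∧
      p.2 ∈ S} ∧
  (∀ A ∈ S, ∃ V : Set (Matrix (Fin n) (Fin n) F), IsOpen V ∧ A ∈ V ∧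
    ∃ a b : Matrix (Fin n) (Fin n) F → Matrix (Fin n) (Fin n) F,
      ContDiffOn ℝ ∞ a (V ∩ S) ∧ ContDiffOn ℝ ∞ b (V ∩ S) ∧
      ∀ B ∈ V ∩ S, (⟨a B, b B⟩ : Complexified (Matrix (Fin n) (Fin n) F)) ∈ UnitaryGpC F n ∧
        moebius ⟨a B, b B⟩ 1 = B)

end Identification

end

set_option linter.unusedSectionVars false

/-! Everything rests on replacing the spectral condition by positivity: a unitary `A` has its
eigenvalues in the open right half-plane exactly when `A + A*` is positive definite. Positive
definiteness is expressed as congruence to `1`, which is meaningful over all three division rings at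
once and transforms transparently. The only arithmetic input on `F` is `star x * x = ‖x‖ ^ 2`.

For `g = a + ib` put `X = aA - b` and `Y = bA + a`. The equation `g*g = 1` gives `X*X = Y*Y` for
unitary `A`, and `Y*X + X*Y = A + A*`. The second identity and positivity make `Y` invertible.
Dividing both by `Y` shows that `XY⁻¹` is unitary with Hermitian part congruent to that of `A`
(`moebius_mem`). The stabilizer of `1` is given by `a - b = a + b`, that is `b = 0`. To reach `B`
from `1`, set `a + b = p` and `a - b = Bp`; then `g*g = 1` says precisely that `p` is a congruence
from the Hermitian part of `B` to `1`. A smooth local square root supplies a smooth `p`, hence local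
sections (`exists_local_section`), and these yield both transitivity and continuity of the inverse
of the orbit map.

The spectral description follows by deformation (`smallRotations_eq_positiveUnitary`). Along the
segment from `1` to `A` the Hermitian part stays invertible, since a kernel vector would give an
eigenvalue of `A` with nonpositive real part; and among invertible Hermitian parts the positive
definite ones are open and closed.

For the classical groups, the involution is identified on the complex matrix side: transpose for
`ℝ`, symplectic adjoint for `ℍ`. For `ℂ`, the pair of values at `g` and `g*` becomes a matrix and
its inverse. -/

noncomputable section

/-! ### Inversion and square roots for bilinear products -/

section BilinearProducts

variable {E : Type*} [NormedAddCommGroup E] [NormedSpace ℝ E] [FiniteDimensional ℝ E]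

/-- A bilinear map on a finite-dimensional space as a bounded family of operators. -/
def bilinearToCLM (m : E →ₗ[ℝ] E →ₗ[ℝ] E) : E →L[ℝ] E →L[ℝ] E :=
  LinearMap.toContinuousLinearMap
    ((LinearMap.toContinuousLinearMap : (E →ₗ[ℝ] E) ≃ₗ[ℝ] (E →L[ℝ] E)).toLinearMap ∘ₗ m)

theorem bilinearToCLM_apply (m : E →ₗ[ℝ] E →ₗ[ℝ] E) (x y : E) :
    bilinearToCLM m x y = m x y := rfl

theorem contDiff_bilinear {k : WithTop ℕ∞} (m : E →ₗ[ℝ] E →ₗ[ℝ] E) :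
    ContDiff ℝ k (fun p : E × E => m p.1 p.2) :=
  (bilinearToCLM m).isBoundedBilinearMap.contDiff

/-- The entrywise sup norm on matrices is not submultiplicative, so inversion is studied in the
Banach algebra of operators, through left multiplications. In finite dimension injectivity suffices
for invertibility. -/
theorem isUnit_bilinearToCLM_iff (m : E →ₗ[ℝ] E →ₗ[ℝ] E) (x : E) :
    IsUnit (bilinearToCLM m x) ↔ Function.Injective (m x) := by
  constructor
  · rintro ⟨u, hu⟩ y z h
    have h1 : (u : E →L[ℝ] E) y = (u : E →L[ℝ] E) z := by rw [hu]; exact h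
    have h2 : ∀ w, (↑u⁻¹ : E →L[ℝ] E) ((u : E →L[ℝ] E) w) = w := fun w => by
      rw [← mul_apply_eq_comp, u.inv_mul]; rfl
    rw [← h2 y, h1, h2 z]
  · intro h
    let e := (LinearEquiv.ofInjectiveEndo (m x) h).toContinuousLinearEquiv
    refine ⟨ContinuousLinearEquiv.toUnit e, ?_⟩
    ext y
    rfl

theorem isOpen_injective_bilinear (m : E →ₗ[ℝ] E →ₗ[ℝ] E) :
    IsOpen {x | Function.Injective (m x)} := by
  have : CompleteSpace E := FiniteDimensional.complete ℝ E
  have h := (Units.isOpen (R := E →L[ℝ] E)).preimage (bilinearToCLM m).continuous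
  convert h using 1
  ext x
  exact (isUnit_bilinearToCLM_iff m x).symm

/-- A local right inverse `x * f x = e` for a bilinear product is smooth. -/
theorem contDiffAt_of_bilinear_eq {k : WithTop ℕ∞} (m : E →ₗ[ℝ] E →ₗ[ℝ] E) (e : E) (f : E → E)
    (hf : ∀ x, Function.Injective (m x) → m x (f x) = e) {x : E}
    (hx : Function.Injective (m x)) : ContDiffAt ℝ k f x := by
  have : CompleteSpace E := FiniteDimensional.complete ℝ E
  have h1 : ContDiffAt ℝ k (fun y => Ring.inverse (bilinearToCLM m y) e) x := by
    obtain ⟨u, hu⟩ := (isUnit_bilinearToCLM_iff m x).2 hx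
    have h2 : ContDiffAt ℝ k (Ring.inverse : (E →L[ℝ] E) → _) (bilinearToCLM m x) := by
      rw [← hu]; exact contDiffAt_ringInverse ℝ u
    exact (h2.comp x (bilinearToCLM m).contDiff.contDiffAt).clm_apply contDiffAt_const
  refine h1.congr_of_eventuallyEq ?_
  filter_upwards [(isOpen_injective_bilinear m).mem_nhds hx] with y hy
  have hu := (isUnit_bilinearToCLM_iff m y).2 hy
  rw [← hf y hy, ← bilinearToCLM_apply, ← mul_apply_eq_comp,
    Ring.inverse_mul_cancel _ hu]
  rfl

/-- Squaring for a unital bilinear product is invertible near the unit, with smooth inverse. -/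
theorem exists_local_sqrt_bilinear (m : E →ₗ[ℝ] E →ₗ[ℝ] E) (e : E) (hl : ∀ x, m e x = x)
    (hr : ∀ x, m x e = x) :
    ∃ (s : E → E) (U W : Set E), IsOpen U ∧ IsOpen W ∧ e ∈ U ∧ e ∈ W ∧ s e = e ∧
      ContDiffOn ℝ ∞ s W ∧ (∀ x ∈ W, s x ∈ U ∧ m (s x) (s x) = x) ∧
      Set.InjOn (fun x => m x x) U := by
  have : CompleteSpace E := FiniteDimensional.complete ℝ E
  -- Class `ω` rather than `∞`: at a single point, `C^ω` propagates to a neighbourhood, whereas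
  -- `C^∞` only gives neighbourhoods depending on the finite order.
  have hc : ContDiff ℝ ω (fun x : E => m x x) :=
    (contDiff_bilinear m).comp (contDiff_id.prodMk contDiff_id)
  -- The derivative of the square at the unit is `x ↦ e x + x e = 2x`.
  let d : E ≃L[ℝ] E := ContinuousLinearEquiv.smulLeft (Units.mk0 (2 : ℝ) two_ne_zero)
  have hd : HasFDerivAt (fun x : E => m x x) (d : E →L[ℝ] E) e := by
    have h := HasFDerivAt.comp (f := fun x : E => (x, x)) e
      ((bilinearToCLM m).isBoundedBilinearMap.hasFDerivAt (e, e))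
      ((hasFDerivAt_id e).prodMk (hasFDerivAt_id e))
    refine h.congr_fderiv ?_
    ext x
    simp [bilinearToCLM_apply, hl, hr, d, two_smul, Units.smul_def]
  have hω : (ω : WithTop ℕ∞) ≠ 0 := by simp
  let φ := hc.contDiffAt.toOpenPartialHomeomorph (fun x : E => m x x) hd hω
  have hφ : ∀ x, φ x = m x x := fun x => rfl
  have he : e ∈ φ.source := hc.contDiffAt.mem_toOpenPartialHomeomorph_source hd hω
  have hs := hc.contDiffAt.to_localInverse hd hω
  have hee : φ e = e := by rw [hφ, hl]
  have hs' : ContDiffAt ℝ ω φ.symm e := by rw [← hee]; exact hs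
  obtain ⟨V, hV, hVo, heV⟩ := eventually_nhds_iff.1 (hs'.eventually (by simp))
  have het : e ∈ φ.target := by have := φ.map_source he; rwa [hee] at this
  refine ⟨φ.symm, φ.source, V ∩ φ.target, φ.open_source, hVo.inter φ.open_target, he,
    ⟨heV, het⟩, ?_, ?_, ?_, φ.injOn⟩
  · conv_lhs => rw [← hee]
    exact φ.left_inv he
  · intro x hx
    exact ((hV x hx.1).of_le le_top).contDiffWithinAt
  · intro x hx
    exact ⟨φ.map_target hx.2, φ.right_inv hx.2⟩

end BilinearProducts

/-! ### Smoothness of the matrix operations -/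

section MatrixTopology

attribute [local instance] Matrix.normedAddCommGroup Matrix.normedSpace

variable {F : Type*} [NormedDivisionRing F] [NormedAlgebra ℝ F] [FiniteDimensional ℝ F] {n : ℕ}

theorem isUnit_matrix_of_injective {A : Matrix (Fin n) (Fin n) F}
    (h : ∀ X : Matrix (Fin n) (Fin n) F, A * X = 0 → X = 0) : IsUnit A := by
  have hi : Function.Injective (LinearMap.mulLeft ℝ A) := by
    rw [← LinearMap.ker_eq_bot, LinearMap.ker_eq_bot']
    exact h
  obtain ⟨B, hB⟩ := LinearMap.injective_iff_surjective.1 hi 1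
  rw [LinearMap.mulLeft_apply] at hB
  refine ⟨⟨A, B, hB, sub_eq_zero.1 (h _ ?_)⟩, rfl⟩
  rw [mul_sub, ← mul_assoc, hB, one_mul, mul_one, sub_self]

theorem injective_mul_iff_isUnit {A : Matrix (Fin n) (Fin n) F} :
    Function.Injective (LinearMap.mul ℝ (Matrix (Fin n) (Fin n) F) A) ↔ IsUnit A := by
  constructor
  · intro h
    exact isUnit_matrix_of_injective fun X hX => h (by simpa using hX)
  · intro h X Y hXY
    exact h.mul_left_cancel hXY

theorem isOpen_isUnit_matrix : IsOpen {A : Matrix (Fin n) (Fin n) F | IsUnit A} := by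
  have h := isOpen_injective_bilinear (LinearMap.mul ℝ (Matrix (Fin n) (Fin n) F))
  simp only [injective_mul_iff_isUnit] at h
  exact h

theorem contDiff_matrix_mul {k : WithTop ℕ∞} :
    ContDiff ℝ k (fun p : Matrix (Fin n) (Fin n) F × Matrix (Fin n) (Fin n) F => p.1 * p.2) :=
  contDiff_bilinear (LinearMap.mul ℝ (Matrix (Fin n) (Fin n) F))

theorem ContDiffOn.matrix_mul {k : WithTop ℕ∞} {E : Type*} [NormedAddCommGroup E]
    [NormedSpace ℝ E] {s : Set E} {f g : E → Matrix (Fin n) (Fin n) F}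
    (hf : ContDiffOn ℝ k f s) (hg : ContDiffOn ℝ k g s) :
    ContDiffOn ℝ k (fun x => f x * g x) s :=
  contDiff_matrix_mul.comp_contDiffOn (hf.prodMk hg)

theorem contDiffAt_matrix_inverse {k : WithTop ℕ∞} {A : Matrix (Fin n) (Fin n) F}
    (hA : IsUnit A) :
    ContDiffAt ℝ k (Ring.inverse : Matrix (Fin n) (Fin n) F → Matrix (Fin n) (Fin n) F) A :=
  contDiffAt_of_bilinear_eq (LinearMap.mul ℝ (Matrix (Fin n) (Fin n) F)) 1 _
    (fun _ h => Ring.mul_inverse_cancel _ (injective_mul_iff_isUnit.1 h))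
    (injective_mul_iff_isUnit.2 hA)

theorem ContDiffOn.matrix_inverse {k : WithTop ℕ∞} {E : Type*} [NormedAddCommGroup E]
    [NormedSpace ℝ E] {s : Set E} {f : E → Matrix (Fin n) (Fin n) F}
    (hf : ContDiffOn ℝ k f s) (hu : ∀ x ∈ s, IsUnit (f x)) :
    ContDiffOn ℝ k (fun x => Ring.inverse (f x)) s := fun x hx =>
  (contDiffAt_matrix_inverse (hu x hx)).comp_contDiffWithinAt x (hf x hx)

theorem exists_local_sqrt_matrix :
    ∃ (s : Matrix (Fin n) (Fin n) F → Matrix (Fin n) (Fin n) F)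
      (U W : Set (Matrix (Fin n) (Fin n) F)), IsOpen U ∧ IsOpen W ∧ 1 ∈ U ∧ 1 ∈ W ∧ s 1 = 1 ∧
      ContDiffOn ℝ ∞ s W ∧ (∀ x ∈ W, s x ∈ U ∧ s x * s x = x) ∧
      Set.InjOn (fun x => x * x) U :=
  exists_local_sqrt_bilinear (LinearMap.mul ℝ (Matrix (Fin n) (Fin n) F)) 1 (by simp) (by simp)

variable [StarRing F] [StarModule ℝ F]

theorem contDiff_matrix_star {k : WithTop ℕ∞} :
    ContDiff ℝ k (fun A : Matrix (Fin n) (Fin n) F => star A) :=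
  (LinearMap.toContinuousLinearMap
    (starLinearEquiv ℝ (A := Matrix (Fin n) (Fin n) F)).toLinearMap).contDiff

end MatrixTopology

/-! ### Positive definite matrices as matrices congruent to the identity -/

section HermitianPart

attribute [local instance] Matrix.normedAddCommGroup Matrix.normedSpace

variable {F : Type*} [NormedDivisionRing F] [StarRing F] {n : ℕ}

/-- Matrices congruent to the identity, i.e. the positive definite Hermitian ones. -/
def IsCongruentToOne (C : Matrix (Fin n) (Fin n) F) : Prop :=
  ∃ r, IsUnit r ∧ star r * C * r = 1

theorem isCongruentToOne_one : IsCongruentToOne (1 : Matrix (Fin n) (Fin n) F) :=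
  ⟨1, isUnit_one, by simp⟩

theorem IsCongruentToOne.exists_eq {C : Matrix (Fin n) (Fin n) F} (h : IsCongruentToOne C) :
    ∃ p, IsUnit p ∧ C = star p * p := by
  obtain ⟨_, ⟨u, rfl⟩, h⟩ := h
  refine ⟨↑u⁻¹, u⁻¹.isUnit, ?_⟩
  have h1 : star (↑u⁻¹ : Matrix (Fin n) (Fin n) F) * star (u : Matrix (Fin n) (Fin n) F) = 1 := by
    rw [← star_mul, u.mul_inv, star_one]
  calc C = star (↑u⁻¹ : Matrix (Fin n) (Fin n) F) * star (u : Matrix (Fin n) (Fin n) F) * C *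
        (u * ↑u⁻¹) := by rw [h1, u.mul_inv, one_mul, mul_one]
    _ = star (↑u⁻¹ : Matrix (Fin n) (Fin n) F) *
        (star (u : Matrix (Fin n) (Fin n) F) * C * u) * ↑u⁻¹ := by simp only [mul_assoc]
    _ = _ := by rw [h, mul_one]

theorem isCongruentToOne_star_mul_self {p : Matrix (Fin n) (Fin n) F} (hp : IsUnit p) :
    IsCongruentToOne (star p * p) := by
  obtain ⟨u, rfl⟩ := hp
  refine ⟨↑u⁻¹, u⁻¹.isUnit, ?_⟩
  rw [mul_assoc, mul_assoc, u.mul_inv, mul_one, ← star_mul, u.mul_inv, star_one]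

theorem IsCongruentToOne.congr {C Z : Matrix (Fin n) (Fin n) F} (h : IsCongruentToOne C)
    (hZ : IsUnit Z) : IsCongruentToOne (star Z * C * Z) := by
  obtain ⟨p, hp, rfl⟩ := h.exists_eq
  have := isCongruentToOne_star_mul_self (hp.mul hZ)
  rwa [star_mul, mul_assoc, ← mul_assoc (star p), ← mul_assoc] at this

variable [NormedAlgebra ℝ F]

/-- The Hermitian part `(A + A^*) / 2`. -/
def hermitianPart (A : Matrix (Fin n) (Fin n) F) : Matrix (Fin n) (Fin n) F :=
  (2⁻¹ : ℝ) • (A + star A)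

/-- The unitary matrices with positive definite Hermitian part. -/
def positiveUnitary (F : Type*) [NormedDivisionRing F] [StarRing F] [NormedAlgebra ℝ F]
    (n : ℕ) :
    Set (Matrix (Fin n) (Fin n) F) :=
  {A | A ∈ UnitaryGp F n ∧ IsCongruentToOne (hermitianPart A)}

/-- The diagonal entry of `p*p` is the sum of the squared norms in the column of `p`. -/
theorem norm_sq_entry_le (hF : ∀ x : F, star x * x = algebraMap ℝ F (‖x‖ ^ 2))
    (p : Matrix (Fin n) (Fin n) F) (i j : Fin n) : ‖p i j‖ ^ 2 ≤ ‖(star p * p) j j‖ := by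
  have h : (star p * p) j j = algebraMap ℝ F (∑ k, ‖p k j‖ ^ 2) := by
    simp [Matrix.mul_apply, Matrix.star_apply, hF]
  rw [h, norm_algebraMap', Real.norm_of_nonneg (Finset.sum_nonneg fun _ _ => by positivity)]
  exact Finset.single_le_sum (f := fun k => ‖p k j‖ ^ 2) (fun _ _ => by positivity)
    (Finset.mem_univ i)

theorem matrix_eq_zero_of_star_mul_self (hF : ∀ x : F, star x * x = algebraMap ℝ F (‖x‖ ^ 2))
    {p : Matrix (Fin n) (Fin n) F} (h : star p * p = 0) : p = 0 := by
  ext i j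
  have := norm_sq_entry_le hF p i j
  rw [h] at this
  simpa using this

theorem norm_sq_le_norm_star_mul_self (hF : ∀ x : F, star x * x = algebraMap ℝ F (‖x‖ ^ 2))
    (p : Matrix (Fin n) (Fin n) F) : ‖p‖ ^ 2 ≤ ‖star p * p‖ := by
  have h : ‖p‖ ≤ √‖star p * p‖ := by
    rw [Matrix.norm_le_iff (Real.sqrt_nonneg _)]
    intro i j
    exact Real.le_sqrt_of_sq_le
      ((norm_sq_entry_le hF p i j).trans (Matrix.norm_entry_le_entrywise_sup_norm _))
  calc ‖p‖ ^ 2 ≤ √‖star p * p‖ ^ 2 := by gcongr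
    _ = _ := Real.sq_sqrt (norm_nonneg _)

theorem IsCongruentToOne.eq_zero (hF : ∀ x : F, star x * x = algebraMap ℝ F (‖x‖ ^ 2))
    {C X : Matrix (Fin n) (Fin n) F} (h : IsCongruentToOne C) (hX : star X * C * X = 0) :
    X = 0 := by
  obtain ⟨p, hp, rfl⟩ := h.exists_eq
  have h1 : star (p * X) * (p * X) = 0 := by
    rw [star_mul, mul_assoc, ← mul_assoc (star p), ← mul_assoc, hX]
  exact hp.mul_right_eq_zero.1 (matrix_eq_zero_of_star_mul_self hF h1)

variable [FiniteDimensional ℝ F]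

/-- Invertibility of `p*p` forces that of `p`. With `isClosed_range_star_mul_self` this makes
positive definiteness a closed condition among invertible matrices. -/
theorem isCongruentToOne_of_isUnit {p : Matrix (Fin n) (Fin n) F} (h : IsUnit (star p * p)) :
    IsCongruentToOne (star p * p) := by
  refine isCongruentToOne_star_mul_self (isUnit_matrix_of_injective fun X hX => ?_)
  refine h.mul_right_eq_zero.1 ?_
  rw [mul_assoc, hX, mul_zero]

theorem mem_unitaryGp_of_star_mul_self {B : Matrix (Fin n) (Fin n) F} (h : star B * B = 1) :
    B ∈ UnitaryGp F n := by
  have hB : IsUnit B := isUnit_matrix_of_injective fun X hX => by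
    rw [← one_mul X, ← h, mul_assoc, hX, mul_zero]
  refine Unitary.mem_iff.2 ⟨h, hB.mul_right_cancel ?_⟩
  rw [mul_assoc, h, mul_one, one_mul]

variable [ContinuousStar F]

/-- The map `p ↦ p*p` is proper because `‖p‖² ≤ ‖p*p‖`: preimages of a convergent sequence are
bounded and have a convergent subsequence. -/
theorem isClosed_range_star_mul_self (hF : ∀ x : F, star x * x = algebraMap ℝ F (‖x‖ ^ 2)) :
    IsClosed (Set.range fun p : Matrix (Fin n) (Fin n) F => star p * p) := by
  have : ProperSpace (Matrix (Fin n) (Fin n) F) := FiniteDimensional.proper ℝ _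
  have : FirstCountableTopology (Matrix (Fin n) (Fin n) F) :=
    inferInstanceAs (FirstCountableTopology (Fin n → Fin n → F))
  refine IsSeqClosed.isClosed ?_
  intro u C hu hC
  choose p hp using hu
  dsimp only at hp
  obtain ⟨R, hR⟩ := (Metric.isBounded_range_of_tendsto u hC).exists_norm_le
  have hb : ∀ k, p k ∈ Metric.closedBall (0 : Matrix (Fin n) (Fin n) F) (√R) := by
    intro k
    rw [mem_closedBall_zero_iff]
    refine Real.le_sqrt_of_sq_le ((norm_sq_le_norm_star_mul_self hF _).trans ?_)
    rw [hp]
    exact hR _ ⟨k, rfl⟩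
  obtain ⟨q, -, φ, hφ, hq⟩ := tendsto_subseq_of_bounded Metric.isBounded_closedBall hb
  refine ⟨q, ?_⟩
  have hc : Continuous fun p : Matrix (Fin n) (Fin n) F => star p * p :=
    continuous_star.mul continuous_id
  have h1 := (hc.tendsto q).comp hq
  have h2 : (fun p : Matrix (Fin n) (Fin n) F => star p * p) ∘ p ∘ φ = u ∘ φ := by
    funext k; exact hp _
  rw [h2] at h1
  exact tendsto_nhds_unique h1 (hC.comp hφ.tendsto_atTop)

/-- Near a matrix congruent to the identity, the congruence can be chosen smoothly. -/
theorem IsCongruentToOne.exists_local_congruence [StarModule ℝ F]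
    {C₀ : Matrix (Fin n) (Fin n) F} (h : IsCongruentToOne C₀) :
    ∃ (W : Set (Matrix (Fin n) (Fin n) F)) (r : Matrix (Fin n) (Fin n) F →
      Matrix (Fin n) (Fin n) F), IsOpen W ∧ C₀ ∈ W ∧ ContDiffOn ℝ ∞ r W ∧
      ∀ C ∈ W, star C = C → IsUnit (r C) ∧ star (r C) * C * r C = 1 := by
  obtain ⟨q, hq, hqC⟩ := h
  obtain ⟨s, U, W, hU, hW, h1U, h1W, hs1, hsW, hs, hinj⟩ :=
    exists_local_sqrt_matrix (F := F) (n := n)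
  have hsc : ContinuousAt s 1 := hsW.continuousOn.continuousAt (hW.mem_nhds h1W)
  -- For `D` near `1` the adjoint of `s D` also lies in `U`, where square roots are unique; hence `s
  -- D` is Hermitian when `D` is.
  have hstar : ∀ᶠ D in nhds (1 : Matrix (Fin n) (Fin n) F), star (s D) ∈ U := by
    have : Filter.Tendsto (fun D => star (s D)) (nhds 1) (nhds (star (s 1))) :=
      (continuous_star.tendsto _).comp hsc
    rw [hs1, star_one] at this
    exact this (hU.mem_nhds h1U)
  obtain ⟨V, hV, hVo, h1V⟩ := eventually_nhds_iff.1 hstar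
  -- The congruence by `q` moves `C₀` to `1`; near `1` the remaining correction is the inverse of
  -- the Hermitian square root.
  let d : Matrix (Fin n) (Fin n) F → Matrix (Fin n) (Fin n) F := fun C => star q * C * q
  have hd : ContDiff ℝ ∞ d := by
    have h1 : ContDiff ℝ ∞ (fun C : Matrix (Fin n) (Fin n) F => star q * C) :=
      contDiff_matrix_mul.comp (contDiff_const.prodMk contDiff_id)
    exact contDiff_matrix_mul.comp (h1.prodMk contDiff_const)
  have hunit : ∀ D, IsUnit D → D ∈ W → IsUnit (s D) := fun D hD hDW => by
    rw [← (hs D hDW).2] at hD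
    exact ((Commute.refl _).isUnit_mul_iff.1 hD).1
  refine ⟨d ⁻¹' (W ∩ V ∩ {D | IsUnit D}), fun C => q * Ring.inverse (s (d C)),
    ((hW.inter hVo).inter isOpen_isUnit_matrix).preimage hd.continuous, ?_, ?_, ?_⟩
  · rw [Set.mem_preimage, show d C₀ = 1 from hqC]
    exact ⟨⟨h1W, h1V⟩, isUnit_one⟩
  · refine contDiffOn_const.matrix_mul (ContDiffOn.matrix_inverse ?_ ?_)
    · exact hsW.comp hd.contDiffOn fun C hC => hC.1.1
    · exact fun C hC => hunit _ hC.2 hC.1.1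
  · intro C hC hCs
    have hu := hunit _ hC.2 hC.1.1
    have hD : star (d C) = d C := by simp only [d, star_mul, star_star, hCs, mul_assoc]
    have hsa : star (s (d C)) = s (d C) := by
      refine hinj (hV _ hC.1.2) (hs _ hC.1.1).1 ?_
      dsimp only
      rw [← star_mul, (hs _ hC.1.1).2, hD]
    obtain ⟨u, hu'⟩ := hu
    have hi : star (↑u⁻¹ : Matrix (Fin n) (Fin n) F) = ↑u⁻¹ := by
      rw [← hu'] at hsa
      refine u.isUnit.mul_left_cancel ?_
      conv_lhs => rw [← hsa]
      rw [← star_mul, u.inv_mul, star_one, u.mul_inv]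
    dsimp only
    rw [← hu', Ring.inverse_unit]
    refine ⟨hq.mul u⁻¹.isUnit, ?_⟩
    have h3 : d C = u * u := by rw [hu', (hs _ hC.1.1).2]
    calc star (q * ↑u⁻¹) * C * (q * ↑u⁻¹) = star (↑u⁻¹ : Matrix (Fin n) (Fin n) F) * d C * ↑u⁻¹ := by
          simp only [d, star_mul, mul_assoc]
      _ = 1 := by rw [hi, h3, ← mul_assoc, u.inv_mul, one_mul, u.mul_inv]

end HermitianPart

/-! ### The action by Möbius transformations -/

section MoebiusAction

variable {F : Type*} [NormedDivisionRing F] [StarRing F] {n : ℕ}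

theorem continuous_complexified_re :
    Continuous (Complexified.re : Complexified (Matrix (Fin n) (Fin n) F) → _) :=
  continuous_fst.comp (continuous_induced_dom
    (f := fun z : Complexified (Matrix (Fin n) (Fin n) F) => (z.re, z.im)))

theorem continuous_complexified_im :
    Continuous (Complexified.im : Complexified (Matrix (Fin n) (Fin n) F) → _) :=
  continuous_snd.comp (continuous_induced_dom
    (f := fun z : Complexified (Matrix (Fin n) (Fin n) F) => (z.re, z.im)))

theorem continuous_complexified_mk {X : Type*} [TopologicalSpace X]
    {a b : X → Matrix (Fin n) (Fin n) F} (ha : Continuous a) (hb : Continuous b) :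
    Continuous (fun x => (⟨a x, b x⟩ : Complexified (Matrix (Fin n) (Fin n) F))) :=
  continuous_induced_rng.2 (ha.prodMk hb)

theorem complexified_star_mul_self_iff {g : Complexified (Matrix (Fin n) (Fin n) F)} :
    star g * g = 1 ↔ star g.re * g.re - star g.im * g.im = 1 ∧
      star g.re * g.im + star g.im * g.re = 0 := by
  rw [Complexified.ext_iff]; rfl

/-- Realized as block matrices with rows `(a, -b)` and `(b, a)`, elements of the complexification
lie in a matrix ring over a division ring, where one-sided inverses are two-sided. -/
theorem mem_unitaryGpC_of_star_mul_self {g : Complexified (Matrix (Fin n) (Fin n) F)}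
    (h : star g * g = 1) : g ∈ UnitaryGpC F n := by
  refine Unitary.mem_iff.2 ⟨h, ?_⟩
  let β : Complexified (Matrix (Fin n) (Fin n) F) → Matrix (Fin n ⊕ Fin n) (Fin n ⊕ Fin n) F :=
    fun z => Matrix.fromBlocks z.re (-z.im) z.im z.re
  have hmul : ∀ z w, β (z * w) = β z * β w := by
    intro z w
    simp only [β, Matrix.fromBlocks_multiply, Complexified.mul_re, Complexified.mul_im]
    congr 1 <;> first | noncomm_ring | exact add_comm _ _
  have hone : β 1 = 1 := by simp [β]
  have hinj : ∀ z w, β z = β w → z = w := by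
    intro z w hzw
    obtain ⟨h1, -, h2, -⟩ := Matrix.fromBlocks_inj.1 hzw
    exact Complexified.ext h1 h2
  apply hinj
  rw [hmul, hone, mul_eq_one_comm, ← hmul, h, hone]

/-- This is `X*X = Y*Y` for numerator `X` and denominator `Y`; it will make `XY⁻¹` unitary. -/
theorem moebius_numerator_star_mul {g : Complexified (Matrix (Fin n) (Fin n) F)}
    (hg : g ∈ UnitaryGpC F n) {A : Matrix (Fin n) (Fin n) F} (hA : star A * A = 1) :
    star (g.re * A - g.im) * (g.re * A - g.im) =
      star (g.im * A + g.re) * (g.im * A + g.re) := by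
  obtain ⟨h1, h2⟩ := complexified_star_mul_self_iff.1 (Unitary.mem_iff.1 hg).1
  have h3 : star g.im * g.re + star g.re * g.im = 0 := by rw [add_comm, h2]
  rw [← sub_eq_zero]
  calc _ = star A * (star g.re * g.re - star g.im * g.im) * A
        - star A * (star g.re * g.im + star g.im * g.re)
        - (star g.im * g.re + star g.re * g.im) * A
        - (star g.re * g.re - star g.im * g.im) := by
        simp only [star_sub, star_mul, star_add]; noncomm_ring
    _ = 0 := by rw [h1, h2, h3, mul_one, hA]; simp

/-- The form `Y*X + X*Y` is preserved by `g`, whether or not `A` is unitary; it controls both the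
invertibility of `Y` and the new Hermitian part. -/
theorem moebius_denominator_star_mul {g : Complexified (Matrix (Fin n) (Fin n) F)}
    (hg : g ∈ UnitaryGpC F n) (A : Matrix (Fin n) (Fin n) F) :
    star (g.im * A + g.re) * (g.re * A - g.im) + star (g.re * A - g.im) * (g.im * A + g.re) =
      A + star A := by
  obtain ⟨h1, h2⟩ := complexified_star_mul_self_iff.1 (Unitary.mem_iff.1 hg).1
  have h3 : star g.im * g.re + star g.re * g.im = 0 := by rw [add_comm, h2]
  calc _ = star A * (star g.im * g.re + star g.re * g.im) * A
        + (star g.re * g.re - star g.im * g.im) * A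
        + star A * (star g.re * g.re - star g.im * g.im)
        - (star g.re * g.im + star g.im * g.re) := by
        simp only [star_sub, star_mul, star_add]; noncomm_ring
    _ = _ := by rw [h1, h2, h3]; simp

theorem moebius_eq_iff {g : Complexified (Matrix (Fin n) (Fin n) F)}
    {A B : Matrix (Fin n) (Fin n) F} (h : IsUnit (g.im * A + g.re)) :
    moebius g A = B ↔ g.re * A - g.im = B * (g.im * A + g.re) := by
  obtain ⟨u, hu⟩ := h
  rw [moebius, ← hu, Ring.inverse_unit, Units.mul_inv_eq_iff_eq_mul]

theorem moebius_one_left (A : Matrix (Fin n) (Fin n) F) : moebius 1 A = A := by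
  simp [moebius]

/-- Numerator and denominator of `g * h` at `A` are those of `g` at `h · A`, multiplied on the right
by the denominator of `h` at `A`. -/
theorem moebius_mul {g h : Complexified (Matrix (Fin n) (Fin n) F)}
    {A : Matrix (Fin n) (Fin n) F} (h1 : IsUnit (h.im * A + h.re))
    (h2 : IsUnit (g.im * moebius h A + g.re)) (h3 : IsUnit ((g * h).im * A + (g * h).re)) :
    moebius (g * h) A = moebius g (moebius h A) := by
  have e1 := (moebius_eq_iff h1).1 rfl
  have e2 := (moebius_eq_iff h2).1 rfl
  rw [moebius_eq_iff h3]
  have e3 : (g * h).re * A - (g * h).im =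
      (g.re * moebius h A - g.im) * (h.im * A + h.re) := by
    rw [sub_mul, mul_assoc, ← e1]
    simp only [Complexified.mul_re, Complexified.mul_im]
    noncomm_ring
  have e4 : (g * h).im * A + (g * h).re =
      (g.im * moebius h A + g.re) * (h.im * A + h.re) := by
    rw [add_mul, mul_assoc, ← e1]
    simp only [Complexified.mul_re, Complexified.mul_im]
    noncomm_ring
  rw [e3, e4, e2, mul_assoc]

variable [NormedAlgebra ℝ F]

theorem one_mem_positiveUnitary : (1 : Matrix (Fin n) (Fin n) F) ∈ positiveUnitary F n := by
  refine ⟨one_mem _, ?_⟩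
  have : hermitianPart (1 : Matrix (Fin n) (Fin n) F) = 1 := by
    rw [hermitianPart, star_one, ← two_smul ℝ, smul_smul]; norm_num
  rw [this]
  exact isCongruentToOne_one

theorem im_eq_zero_of_moebius_one {g : Complexified (Matrix (Fin n) (Fin n) F)}
    (hu : IsUnit (g.im * 1 + g.re)) (h : moebius g 1 = 1) : g.im = 0 := by
  rw [moebius_eq_iff hu, mul_one, mul_one, one_mul] at h
  have h2 : (2 : ℝ) • g.im = 0 := by
    rw [two_smul]
    calc g.im + g.im = (g.im + g.re) - (g.re - g.im) := by abel
      _ = 0 := by rw [h, sub_self]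
  exact (smul_eq_zero.1 h2).resolve_left two_ne_zero

theorem mem_realForm_iff {g : UnitaryGpC F n} : g ∈ realForm F n ↔ g.1.im = 0 := by
  constructor
  · rintro ⟨a, rfl⟩
    rfl
  · intro h
    obtain ⟨h1, h2⟩ := Unitary.mem_iff.1 g.2
    have e1 := congrArg Complexified.re h1
    have e2 := congrArg Complexified.re h2
    simp only [Complexified.mul_re, Complexified.star_re, Complexified.star_im,
      Complexified.one_re, h, mul_zero, star_zero, sub_zero] at e1 e2
    exact ⟨⟨g.1.re, Unitary.mem_iff.2 ⟨e1, e2⟩⟩, Subtype.ext (Complexified.ext rfl h.symm)⟩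

variable [FiniteDimensional ℝ F]

/-- If the denominator kills `X`, then `X*(A + A*)X = 0`, so `X = 0` by definiteness. -/
theorem isUnit_moebius_denominator (hF : ∀ x : F, star x * x = algebraMap ℝ F (‖x‖ ^ 2))
    {g : Complexified (Matrix (Fin n) (Fin n) F)} (hg : g ∈ UnitaryGpC F n)
    {A : Matrix (Fin n) (Fin n) F} (hA : A ∈ positiveUnitary F n) :
    IsUnit (g.im * A + g.re) := by
  refine isUnit_matrix_of_injective fun X hX => hA.2.eq_zero hF ?_
  have h1 : star X * (A + star A) * X = 0 := by
    rw [← moebius_denominator_star_mul hg A]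
    generalize g.im * A + g.re = Y at hX
    generalize g.re * A - g.im = Z
    calc _ = star (Y * X) * (Z * X) + star (Z * X) * (Y * X) := by
          simp only [star_mul, mul_add, add_mul, mul_assoc]
      _ = 0 := by rw [hX]; simp
  rw [hermitianPart, mul_smul_comm, smul_mul_assoc, h1, smul_zero]

/-- Multiplying the two identities by `Y⁻*` on the left and `Y⁻¹` on the right gives unitarity and a
congruence, by `Y⁻¹`, between the Hermitian parts. -/
theorem moebius_mem (hF : ∀ x : F, star x * x = algebraMap ℝ F (‖x‖ ^ 2))
    {g : Complexified (Matrix (Fin n) (Fin n) F)} (hg : g ∈ UnitaryGpC F n)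
    {A : Matrix (Fin n) (Fin n) F} (hA : A ∈ positiveUnitary F n) :
    moebius g A ∈ positiveUnitary F n := by
  have hAu := (Unitary.mem_iff.1 hA.1).1
  have e1 := moebius_numerator_star_mul hg hAu
  have e2 := moebius_denominator_star_mul hg A
  have hY := isUnit_moebius_denominator hF hg hA
  obtain ⟨u, hu⟩ := hY
  have hm : moebius g A =
      (g.re * A - g.im) * ((u⁻¹ : (Matrix (Fin n) (Fin n) F)ˣ) : Matrix (Fin n) (Fin n) F) := by
    rw [moebius, ← hu, Ring.inverse_unit]
  rw [← hu] at e1 e2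
  have hs : star (↑u⁻¹ : Matrix (Fin n) (Fin n) F) * star (u : Matrix (Fin n) (Fin n) F) = 1 := by
    rw [← star_mul, u.mul_inv, star_one]
  generalize g.re * A - g.im = X at e1 e2 hm
  constructor
  · apply mem_unitaryGp_of_star_mul_self
    calc star (moebius g A) * moebius g A
        = star (↑u⁻¹ : Matrix (Fin n) (Fin n) F) * (star X * X) * ↑u⁻¹ := by
          rw [hm, star_mul]; simp only [mul_assoc]
      _ = (star (↑u⁻¹ : Matrix (Fin n) (Fin n) F) * star (u : Matrix (Fin n) (Fin n) F)) *
          (u * ↑u⁻¹) := by rw [e1]; simp only [mul_assoc]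
      _ = 1 := by rw [hs, u.mul_inv, one_mul]
  · have : hermitianPart (moebius g A) =
        star (↑u⁻¹ : Matrix (Fin n) (Fin n) F) * hermitianPart A *
          (↑u⁻¹ : Matrix (Fin n) (Fin n) F) := by
      rw [hermitianPart, hermitianPart, mul_smul_comm, smul_mul_assoc, ← e2, hm]
      congr 1
      calc _ = (star (↑u⁻¹ : Matrix (Fin n) (Fin n) F) * star (u : Matrix (Fin n) (Fin n) F)) *
            X * ↑u⁻¹ + star (X * ↑u⁻¹ : Matrix (Fin n) (Fin n) F) * (u * ↑u⁻¹) := by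
            rw [hs, u.mul_inv, one_mul, mul_one]
        _ = _ := by simp only [star_mul, mul_add, add_mul, mul_assoc]
    rw [this]
    exact hA.2.congr u⁻¹.isUnit

/-- The action of the complexified unitary group by Möbius transformations. -/
@[reducible]
def moebiusAction (hF : ∀ x : F, star x * x = algebraMap ℝ F (‖x‖ ^ 2)) :
    MulAction (UnitaryGpC F n) (positiveUnitary F n) where
  smul g A := ⟨moebius g.1 A.1, moebius_mem hF g.2 A.2⟩
  one_smul A := Subtype.ext (moebius_one_left A.1)
  mul_smul g h A := Subtype.ext <| moebius_mul (isUnit_moebius_denominator hF h.2 A.2)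
    (isUnit_moebius_denominator hF g.2 (moebius_mem hF h.2 A.2))
    (isUnit_moebius_denominator hF (g * h).2 A.2)

end MoebiusAction

/-! ### Local sections and the quotient -/

section Identification

attribute [local instance] Matrix.normedAddCommGroup Matrix.normedSpace

variable {F : Type*} [NormedDivisionRing F] [StarRing F] [NormedAlgebra ℝ F]
  [FiniteDimensional ℝ F] [ContinuousStar F] [StarModule ℝ F] {n : ℕ}

theorem star_hermitianPart (A : Matrix (Fin n) (Fin n) F) :
    star (hermitianPart A) = hermitianPart A := by
  rw [hermitianPart, star_smul, star_add, star_star, add_comm, star_trivial]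

theorem contDiff_hermitianPart {k : WithTop ℕ∞} :
    ContDiff ℝ k (hermitianPart : Matrix (Fin n) (Fin n) F → _) :=
  (contDiff_id.add contDiff_matrix_star).const_smul (2⁻¹ : ℝ)

theorem isOpen_isCongruentToOne_hermitianPart :
    IsOpen {A : Matrix (Fin n) (Fin n) F | IsCongruentToOne (hermitianPart A)} := by
  rw [isOpen_iff_mem_nhds]
  intro A hA
  obtain ⟨W, r, hW, hAW, -, hr⟩ := IsCongruentToOne.exists_local_congruence hA
  have hc := (contDiff_hermitianPart (F := F) (n := n) (k := 0)).continuous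
  filter_upwards [(hW.preimage hc).mem_nhds hAW] with B hB
  exact ⟨r _, hr _ hB (star_hermitianPart B)⟩

/-- Solving `a + b = p`, `a - b = Bp` gives `a = (1 + B)p/2` and `b = (1 - B)p/2`. Then `a*a - b*b =
p*((B + B*)/2)p` and `a*b + b*a = p*(1 - B*B)p/2`, so `p` must carry the Hermitian part of `B` to
`1`. -/
theorem exists_local_section {A : Matrix (Fin n) (Fin n) F} (hA : A ∈ positiveUnitary F n) :
    ∃ V : Set (Matrix (Fin n) (Fin n) F), IsOpen V ∧ A ∈ V ∧
    ∃ a b : Matrix (Fin n) (Fin n) F → Matrix (Fin n) (Fin n) F,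
      ContDiffOn ℝ ∞ a (V ∩ positiveUnitary F n) ∧ ContDiffOn ℝ ∞ b (V ∩ positiveUnitary F n) ∧
      ∀ B ∈ V ∩ positiveUnitary F n,
        (⟨a B, b B⟩ : Complexified (Matrix (Fin n) (Fin n) F)) ∈ UnitaryGpC F n ∧
        moebius ⟨a B, b B⟩ 1 = B := by
  obtain ⟨W, r, hW, hAW, hrW, hr⟩ := hA.2.exists_local_congruence
  have hc := (contDiff_hermitianPart (F := F) (n := n) (k := 0)).continuous
  have hrs : ContDiffOn ℝ ∞ (fun B => r (hermitianPart B))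
      (hermitianPart ⁻¹' W ∩ positiveUnitary F n) :=
    hrW.comp contDiff_hermitianPart.contDiffOn fun B hB => hB.1
  refine ⟨hermitianPart ⁻¹' W, hW.preimage hc, hAW,
    fun B => (2⁻¹ : ℝ) • ((1 + B) * r (hermitianPart B)),
    fun B => (2⁻¹ : ℝ) • ((1 - B) * r (hermitianPart B)), ?_, ?_, ?_⟩
  · exact ((contDiffOn_const.add contDiffOn_id).matrix_mul hrs).const_smul (2⁻¹ : ℝ)
  · exact ((contDiffOn_const.sub contDiffOn_id).matrix_mul hrs).const_smul (2⁻¹ : ℝ)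
  · intro B hB
    obtain ⟨hu, hC⟩ := hr _ hB.1 (star_hermitianPart B)
    have hBB := (Unitary.mem_iff.1 hB.2.1).1
    dsimp only
    generalize r (hermitianPart B) = p at hu hC
    rw [hermitianPart] at hC
    have hsum : (2⁻¹ : ℝ) • ((1 - B) * p) + (2⁻¹ : ℝ) • ((1 + B) * p) = p := by
      rw [← smul_add, ← add_mul, sub_add_add_cancel, one_add_one_eq_two, two_mul, ← two_smul ℝ,
        smul_smul]
      norm_num
    have hdiff : (2⁻¹ : ℝ) • ((1 + B) * p) - (2⁻¹ : ℝ) • ((1 - B) * p) = B * p := by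
      rw [← smul_sub, ← sub_mul, add_sub_sub_cancel, add_mul, ← two_smul ℝ,
        smul_smul]
      norm_num
    constructor
    · apply mem_unitaryGpC_of_star_mul_self
      rw [complexified_star_mul_self_iff]
      dsimp only
      simp only [star_smul, star_trivial, smul_mul_smul_comm, star_mul]
      constructor
      · rw [← smul_sub, mul_smul]
        refine Eq.trans ?_ hC
        rw [mul_smul_comm, smul_mul_assoc]
        congr 1
        calc _ = (2⁻¹ : ℝ) • ((2 : ℝ) • (star p * (B + star B) * p)) := by
              rw [two_smul]
              congr 1
              simp only [star_add, star_sub, star_one]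
              noncomm_ring
          _ = _ := by rw [smul_smul]; norm_num
      · rw [← smul_add]
        have : star p * star (1 + B) * ((1 - B) * p) + star p * star (1 - B) * ((1 + B) * p) =
            2 * (star p * p) - 2 * (star p * (star B * B) * p) := by
          simp only [star_add, star_sub, star_one]
          noncomm_ring
        rw [this, hBB, mul_one, sub_self, smul_zero]
    · rw [moebius_eq_iff]
      · simp only [mul_one]
        rw [hsum, hdiff]
      · simp only [mul_one]
        rwa [hsum]

theorem contDiffOn_moebius (hF : ∀ x : F, star x * x = algebraMap ℝ F (‖x‖ ^ 2)) :
    ContDiffOn ℝ ∞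
    (fun p : (Matrix (Fin n) (Fin n) F × Matrix (Fin n) (Fin n) F) × Matrix (Fin n) (Fin n) F =>
      moebius ⟨p.1.1, p.1.2⟩ p.2)
    {p | (⟨p.1.1, p.1.2⟩ : Complexified (Matrix (Fin n) (Fin n) F)) ∈ UnitaryGpC F n ∧
      p.2 ∈ positiveUnitary F n} := by
  unfold moebius
  have h1 : ContDiff ℝ ∞ (fun p : (Matrix (Fin n) (Fin n) F × Matrix (Fin n) (Fin n) F) ×
      Matrix (Fin n) (Fin n) F => p.1.1) := contDiff_fst.comp contDiff_fst
  have h2 : ContDiff ℝ ∞ (fun p : (Matrix (Fin n) (Fin n) F × Matrix (Fin n) (Fin n) F) ×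
      Matrix (Fin n) (Fin n) F => p.1.2) := contDiff_snd.comp contDiff_fst
  refine ContDiffOn.matrix_mul ?_ (ContDiffOn.matrix_inverse ?_ ?_)
  · exact (h1.contDiffOn.matrix_mul contDiffOn_snd).sub h2.contDiffOn
  · exact (h2.contDiffOn.matrix_mul contDiffOn_snd).add h1.contDiffOn
  · exact fun p hp => isUnit_moebius_denominator hF hp.1 hp.2

theorem naturallyIdentified_positiveUnitary
    (hF : ∀ x : F, star x * x = algebraMap ℝ F (‖x‖ ^ 2)) :
    NaturallyIdentified F n (positiveUnitary F n) := by
  refine ⟨⟨_, isOpen_isCongruentToOne_hermitianPart, ?_⟩, ?_, contDiffOn_moebius hF,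
    fun A hA => exists_local_section hA⟩
  · ext A
    exact and_comm
  let act := moebiusAction (n := n) hF
  have hact : ∀ (g : UnitaryGpC F n) (A : positiveUnitary F n),
      ((g • A : positiveUnitary F n) : Matrix (Fin n) (Fin n) F) = moebius g.1 A.1 :=
    fun _ _ => rfl
  let o : positiveUnitary F n := ⟨1, one_mem_positiveUnitary⟩
  have hstab : ∀ g : UnitaryGpC F n, g ∈ realForm F n ↔ g • o = o := by
    intro g
    have hu := isUnit_moebius_denominator hF g.2 (one_mem_positiveUnitary (F := F) (n := n))
    rw [mem_realForm_iff, Subtype.ext_iff, hact]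
    refine ⟨fun h => ?_, im_eq_zero_of_moebius_one hu⟩
    rw [moebius_eq_iff hu]
    simp [o, h]
  -- The fibres of the orbit map are the left cosets of the stabilizer.
  have hrel : ∀ g h : UnitaryGpC F n, g⁻¹ * h ∈ realForm F n ↔ g • o = h • o := by
    intro g h
    rw [hstab, mul_smul, inv_smul_eq_iff, eq_comm]
  let Φ₀ : UnitaryGpC F n ⧸ realForm F n → positiveUnitary F n :=
    Quotient.lift (fun g => g • o) fun g h hgh => (hrel g h).1 (QuotientGroup.leftRel_apply.1 hgh)
  have hΦ₀ : ∀ g : UnitaryGpC F n, Φ₀ (QuotientGroup.mk g) = g • o := fun _ => rfl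
  have hbij : Function.Bijective Φ₀ := by
    constructor
    · intro x y
      induction x using QuotientGroup.induction_on
      induction y using QuotientGroup.induction_on
      rw [hΦ₀, hΦ₀, ← hrel]
      exact fun h => QuotientGroup.eq.2 h
    · rintro ⟨A, hA⟩
      obtain ⟨V, -, hAV, a, b, -, -, hab⟩ := exists_local_section hA
      obtain ⟨h1, h2⟩ := hab A ⟨hAV, hA⟩
      exact ⟨QuotientGroup.mk ⟨_, h1⟩, Subtype.ext h2⟩
  have hcont : Continuous Φ₀ := by
    refine Continuous.quotient_lift (Continuous.subtype_mk ?_ _) _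
    have h1 : ContinuousOn (fun p : (Matrix (Fin n) (Fin n) F × Matrix (Fin n) (Fin n) F) ×
      Matrix (Fin n) (Fin n) F => moebius ⟨p.1.1, p.1.2⟩ p.2) _ :=
        (contDiffOn_moebius (n := n) hF).continuousOn
    refine h1.comp_continuous (f := fun g : UnitaryGpC F n => ((g.1.re, g.1.im), 1)) ?_
      fun g => ⟨g.2, one_mem_positiveUnitary⟩
    exact ((continuous_complexified_re.comp continuous_subtype_val).prodMk
      (continuous_complexified_im.comp continuous_subtype_val)).prodMk continuous_const
  let Φe := Equiv.ofBijective Φ₀ hbij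
  -- Locally the inverse is a smooth section followed by the quotient projection.
  have hinv : Continuous Φe.symm := by
    rw [continuous_iff_continuousAt]
    rintro ⟨A, hA⟩
    obtain ⟨V, hV, hAV, a, b, ha, hb, hab⟩ := exists_local_section hA
    have hV' : IsOpen ((fun B : positiveUnitary F n => B.1) ⁻¹' V) :=
      hV.preimage continuous_subtype_val
    refine ContinuousOn.continuousAt ?_ (hV'.mem_nhds hAV)
    rw [continuousOn_iff_continuous_domRestrict]
    have hmem : ∀ x : (fun B : positiveUnitary F n => B.1) ⁻¹' V,
        x.1.1 ∈ V ∩ positiveUnitary F n := fun x => ⟨x.2, x.1.2⟩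
    have hval : Continuous fun x : (fun B : positiveUnitary F n => B.1) ⁻¹' V => x.1.1 :=
      continuous_subtype_val.comp continuous_subtype_val
    have hσ : Continuous fun x : (fun B : positiveUnitary F n => B.1) ⁻¹' V =>
        (QuotientGroup.mk (⟨⟨a x.1.1, b x.1.1⟩, (hab _ (hmem x)).1⟩ : UnitaryGpC F n) :
          UnitaryGpC F n ⧸ realForm F n) :=
      continuous_quotient_mk'.comp (Continuous.subtype_mk (continuous_complexified_mk
        (ha.continuousOn.comp_continuous hval hmem)
        (hb.continuousOn.comp_continuous hval hmem)) _)
    convert hσ using 1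
    funext x
    rw [Set.domRestrict_apply, Equiv.symm_apply_eq]
    exact Subtype.ext (hab _ (hmem x)).2.symm
  refine ⟨act, ⟨Φe, hcont, hinv⟩,
    fun g A => ⟨isUnit_moebius_denominator hF g.2 A.2, rfl⟩, fun g => rfl, ?_⟩
  intro g x
  induction x using QuotientGroup.induction_on with
  | H h => exact mul_smul g h o

end Identification

/-! ### Spectrum in the right half-plane versus positive Hermitian part -/

section Spectrum

attribute [local instance] Matrix.normedAddCommGroup Matrix.normedSpace

variable {F : Type*} [NormedDivisionRing F] [StarRing F] [NormedAlgebra ℝ F] {n : ℕ}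

/-- If `A` is unitary without eigenvalues in the closed left half-plane, the segment from `1` to
`A` avoids the matrices with singular Hermitian part. -/
theorem isUnit_hermitianPart_of_mem_segment [FiniteDimensional ℝ F] [StarModule ℝ F]
    {A : Matrix (Fin n) (Fin n) F} (hA : A ∈ UnitaryGp F n)
    (hneg : ∀ (l : ℝ) (v : Fin n → F), l ≤ 0 → v ≠ 0 → A *ᵥ (A *ᵥ v) + v ≠ l • (A *ᵥ v))
    {B : Matrix (Fin n) (Fin n) F} (hB : B ∈ segment ℝ 1 A) : IsUnit (hermitianPart B) := by
  obtain ⟨s, t, hs, ht, hst, rfl⟩ := hB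
  refine isUnit_matrix_of_injective fun X hX => ?_
  have h1 : s • X + t • ((2⁻¹ : ℝ) • (A * X + star A * X)) = 0 := by
    rw [← hX, hermitianPart]
    simp only [star_add, star_smul, star_trivial, star_one, add_mul, smul_mul_assoc, one_mul,
      smul_add]
    have : s • X = (2⁻¹ : ℝ) • s • X + (2⁻¹ : ℝ) • s • X := by
      rw [← add_smul]; norm_num
    conv_lhs => rw [this, smul_comm t (2⁻¹ : ℝ), smul_comm t (2⁻¹ : ℝ)]
    abel
  rcases ht.eq_or_lt with rfl | ht
  · have : s = 1 := by linarith
    simpa [this] using h1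
  -- Multiplying the kernel equation by `A` and using `AA* = 1` turns it into a quadratic equation
  -- for `A` on the columns of `X`.
  have h2 : A * (A * X) + X = (-(2 * s / t)) • (A * X) := by
    have h3 := congrArg (A * ·) h1
    simp only [mul_add, mul_smul_comm, mul_zero, ← mul_assoc A (star A),
      (Unitary.mem_iff.1 hA).2, one_mul] at h3
    have h4 : A * (A * X) + X = (2 / t) • (t • ((2⁻¹ : ℝ) • (A * (A * X) + X))) := by
      rw [smul_smul, smul_smul, show 2 / t * t * 2⁻¹ = 1 by field_simp, one_smul]
    rw [h4, eq_neg_of_add_eq_zero_right h3, smul_neg, smul_smul, neg_smul]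
    congr 2
    ring
  by_contra hX0
  obtain ⟨i, j, hij⟩ : ∃ i j, X i j ≠ 0 := by
    by_contra! h
    exact hX0 (Matrix.ext h)
  refine hneg (-(2 * s / t)) (fun i => X i j) (by simp; positivity)
    (fun h => hij (congrFun h i)) ?_
  funext k
  exact congrFun (congrFun h2 k) j

/-- A description of the unitary matrices with spectrum in the right half-plane, by deformation
to the identity. -/
theorem smallRotations_eq_positiveUnitary [FiniteDimensional ℝ F] [StarModule ℝ F]
    [ContinuousStar F] (hF : ∀ x : F, star x * x = algebraMap ℝ F (‖x‖ ^ 2))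
    (eig : Matrix (Fin n) (Fin n) F → Set ℂ)
    (hpos : ∀ A, IsCongruentToOne (hermitianPart A) → ∀ μ ∈ eig A, 0 < μ.re)
    (hneg : ∀ (A : Matrix (Fin n) (Fin n) F) (l : ℝ) (v : Fin n → F), l ≤ 0 → v ≠ 0 →
      A *ᵥ (A *ᵥ v) + v = l • (A *ᵥ v) → ∃ μ ∈ eig A, μ.re ≤ 0) :
    smallRotations eig = positiveUnitary F n := by
  ext A
  refine ⟨fun ⟨hA, hμ⟩ => ⟨hA, ?_⟩, fun ⟨hA, hC⟩ => ⟨hA, hpos A hC⟩⟩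
  have hseg : ∀ B ∈ segment ℝ 1 A, IsUnit (hermitianPart B) := fun B hB =>
    isUnit_hermitianPart_of_mem_segment hA (fun l v hl hv h => by
      obtain ⟨μ, h1, h2⟩ := hneg A l v hl hv h
      exact absurd (hμ μ h1) (not_lt.2 h2)) hB
  have hpre : IsPreconnected (segment ℝ 1 A) := (convex_segment 1 A).isPreconnected
  -- The segment is connected and meets the open positive set at `1`, so it suffices that this set
  -- is closed relative to the segment.
  refine hpre.subset_of_closure_inter_subset
    (u := {B | IsCongruentToOne (hermitianPart B)}) isOpen_isCongruentToOne_hermitianPart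
    ⟨1, left_mem_segment ℝ 1 A, one_mem_positiveUnitary.2⟩ ?_ (right_mem_segment ℝ 1 A)
  rintro B ⟨hBc, hBs⟩
  have hc := (contDiff_hermitianPart (F := F) (n := n) (k := 0)).continuous
  have hB : hermitianPart B ∈ Set.range fun p : Matrix (Fin n) (Fin n) F => star p * p := by
    refine closure_minimal (s := {B | IsCongruentToOne (hermitianPart B)}) ?_
      ((isClosed_range_star_mul_self hF).preimage hc) hBc
    intro B' hB'
    obtain ⟨p, -, hp⟩ := IsCongruentToOne.exists_eq hB'
    exact ⟨p, hp.symm⟩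
  obtain ⟨p, hp⟩ := hB
  have hu := hseg B hBs
  rw [Set.mem_ofPred_eq, ← hp]
  rw [← hp] at hu
  exact isCongruentToOne_of_isUnit hu

theorem star_dotProduct_self_eq (hF : ∀ x : F, star x * x = algebraMap ℝ F (‖x‖ ^ 2))
    (v : Fin n → F) : star v ⬝ᵥ v = algebraMap ℝ F (∑ i, ‖v i‖ ^ 2) := by
  simp [dotProduct, hF]

theorem sum_norm_sq_pos {v : Fin n → F} (hv : v ≠ 0) : 0 < ∑ i, ‖v i‖ ^ 2 := by
  obtain ⟨i, hi⟩ := Function.ne_iff.1 hv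
  exact Finset.sum_pos' (fun _ _ => by positivity)
    ⟨i, Finset.mem_univ i, by have := norm_pos_iff.2 hi; positivity⟩

/-- Evaluating `v*(A + A*)v` in two ways gives `2 Re μ ‖v‖² = 2 ‖pv‖²` in Euclidean norms, where the
Hermitian part is `p*p`. The embedding `φ` of `ℂ` in `F` treats `ℂ` and `ℍ` together, with
eigenvalues acting on the right. -/
theorem re_pos_of_mulVec_eq (hF : ∀ x : F, star x * x = algebraMap ℝ F (‖x‖ ^ 2))
    (φ : ℂ →ₐ[ℝ] F) (hφ : ∀ z, star (φ z) = φ (star z)) {A : Matrix (Fin n) (Fin n) F}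
    (hA : IsCongruentToOne (hermitianPart A)) {μ : ℂ} {v : Fin n → F} (hv : v ≠ 0)
    (h : A *ᵥ v = fun k => v k * φ μ) : 0 < μ.re := by
  obtain ⟨p, hp, hpA⟩ := hA.exists_eq
  have h1 : star v ⬝ᵥ (A *ᵥ v) = algebraMap ℝ F (∑ i, ‖v i‖ ^ 2) * φ μ := by
    rw [← star_dotProduct_self_eq hF, h]
    simp only [dotProduct, Finset.sum_mul, mul_assoc]
  have h2 : star v ⬝ᵥ (star A *ᵥ v) = algebraMap ℝ F (∑ i, ‖v i‖ ^ 2) * φ (star μ) := by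
    rw [Matrix.dotProduct_mulVec, Matrix.star_eq_conjTranspose, ← Matrix.star_mulVec,
      Algebra.commutes, ← star_dotProduct_self_eq hF, h]
    simp only [dotProduct, Finset.mul_sum, Pi.star_apply, star_mul, mul_assoc, hφ]
  have h3 : star v ⬝ᵥ ((star p * p) *ᵥ v) = algebraMap ℝ F (∑ i, ‖(p *ᵥ v) i‖ ^ 2) := by
    rw [← star_dotProduct_self_eq hF, ← Matrix.mulVec_mulVec, Matrix.dotProduct_mulVec,
      Matrix.star_eq_conjTranspose, ← Matrix.star_mulVec]
  have hpv : p *ᵥ v ≠ 0 := by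
    obtain ⟨u, rfl⟩ := hp
    intro h0
    apply hv
    rw [← Matrix.one_mulVec v, ← u.inv_mul, ← Matrix.mulVec_mulVec, h0, Matrix.mulVec_zero]
  have h4 : A + star A = (2 : ℝ) • (star p * p) := by
    rw [← hpA, hermitianPart, smul_smul]; norm_num
  have h5 := congrArg (fun B => star v ⬝ᵥ (B *ᵥ v)) h4
  simp only [Matrix.add_mulVec, dotProduct_add, h1, h2, Matrix.smul_mulVec,
    dotProduct_smul, h3] at h5
  have h6 : φ μ + φ (star μ) = algebraMap ℝ F (2 * μ.re) := by
    rw [← map_add, ← φ.commutes]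
    congr 1
    apply Complex.ext <;> simp [two_mul]
  rw [← mul_add, h6, ← map_mul, Algebra.smul_def, ← map_mul] at h5
  have h7 := (algebraMap ℝ F).injective h5
  have h8 := sum_norm_sq_pos hv
  have h9 := sum_norm_sq_pos hpv
  have h10 : 0 < (∑ i, ‖v i‖ ^ 2) * (2 * μ.re) := by rw [h7]; positivity
  have := (mul_pos_iff_of_pos_left h8).1 h10
  linarith

/-- A root `z` of `z² - lz + 1` is either real, and then cannot be positive when `l ≤ 0`, or has
real part `l/2`. -/
theorem exists_root_re_nonpos {l : ℝ} (hl : l ≤ 0) :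
    ∃ μ ν : ℂ, μ + ν = l ∧ μ * ν = 1 ∧ μ.re ≤ 0 ∧ ν.re ≤ 0 := by
  have key : ∀ z : ℂ, z * (l - z) = 1 → z.re ≤ 0 := by
    intro z hz
    have h1 := congrArg Complex.re hz
    have h2 := congrArg Complex.im hz
    simp at h1 h2
    by_contra! hpos
    have h3 : z.im * (l - 2 * z.re) = 0 := by linarith
    rcases mul_eq_zero.1 h3 with h | h
    · rw [h] at h1
      nlinarith
    · linarith
  obtain ⟨d, hd⟩ := IsAlgClosed.exists_eq_mul_self ((l : ℂ) ^ 2 - 4)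
  have e1 : ((l : ℂ) + d) / 2 * ((l - d) / 2) = 1 := by linear_combination (1 / 4) * hd
  refine ⟨(l + d) / 2, (l - d) / 2, by ring, e1, key _ ?_, key _ ?_⟩
  · rw [← e1]; ring
  · rw [← e1]; ring

/-- Factor the quadratic with roots `μ, ν`: either `v` is an eigenvector for `μ`, or `Av - vμ` is a
nonzero eigenvector for `ν`. Scalars stay on the right, where they commute with `A`. -/
theorem exists_eigenvector_re_nonpos (φ : ℂ →ₐ[ℝ] F) (A : Matrix (Fin n) (Fin n) F) {l : ℝ}
    (hl : l ≤ 0) {v : Fin n → F} (hv : v ≠ 0) (h : A *ᵥ (A *ᵥ v) + v = l • (A *ᵥ v)) :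
    ∃ μ : ℂ, (∃ w : Fin n → F, w ≠ 0 ∧ A *ᵥ w = fun k => w k * φ μ) ∧ μ.re ≤ 0 := by
  obtain ⟨μ, ν, hsum, hprod, hμ, hν⟩ := exists_root_re_nonpos hl
  have hright : ∀ (w : Fin n → F) (c : F), A *ᵥ (fun k => w k * c) = fun k => (A *ᵥ w) k * c := by
    intro w c
    funext k
    simp only [Matrix.mulVec, dotProduct, Finset.sum_mul, mul_assoc]
  by_cases hw : A *ᵥ v = fun k => v k * φ μ
  · exact ⟨μ, ⟨v, hv, hw⟩, hμ⟩
  · refine ⟨ν, ⟨A *ᵥ v - fun k => v k * φ μ, sub_ne_zero.2 hw, ?_⟩, hν⟩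
    rw [Matrix.mulVec_sub, hright, eq_sub_of_add_eq h]
    funext k
    have e1 : φ μ + φ ν = algebraMap ℝ F l := by
      rw [← map_add, hsum, ← φ.commutes]; rfl
    have e2 : φ μ * φ ν = 1 := by rw [← map_mul, hprod, map_one]
    simp only [Pi.sub_apply, Pi.smul_apply, sub_mul, mul_assoc, e2, mul_one]
    rw [Algebra.smul_def, Algebra.commutes, ← e1, mul_add]
    abel

end Spectrum

/-! ### The spectral description over the three division rings -/

section Instances

theorem smallRotations_complex (n : ℕ) :
    smallRotations eigenvaluesComplex = positiveUnitary ℂ n := by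
  have hF : ∀ x : ℂ, star x * x = algebraMap ℝ ℂ (‖x‖ ^ 2) := fun x => by
    rw [Complex.star_def, Complex.conj_mul']; simp
  refine smallRotations_eq_positiveUnitary hF _ ?_ ?_
  · rintro A hA μ ⟨v, hv, h⟩
    refine re_pos_of_mulVec_eq hF (AlgHom.id ℝ ℂ) (fun _ => rfl) hA hv ?_
    rw [h]
    funext k
    simp [mul_comm]
  · intro A l v hl hv h
    obtain ⟨μ, ⟨w, hw, hAw⟩, hμ⟩ := exists_eigenvector_re_nonpos (AlgHom.id ℝ ℂ) A hl hv h
    refine ⟨μ, ⟨w, hw, ?_⟩, hμ⟩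
    rw [hAw]
    funext k
    simp [mul_comm]

theorem star_mul_self_quaternion (x : ℍ) : star x * x = algebraMap ℝ ℍ (‖x‖ ^ 2) := by
  rw [Quaternion.star_mul_self, Quaternion.normSq_eq_norm_mul_self, sq]; rfl

instance : StarModule ℝ ℍ := ⟨fun r x => by ext <;> simp⟩

theorem smallRotations_quaternion (n : ℕ) :
    smallRotations eigenvaluesQuaternion = positiveUnitary ℍ n := by
  refine smallRotations_eq_positiveUnitary star_mul_self_quaternion _ ?_ ?_
  · rintro A hA μ ⟨v, hv, h⟩
    exact re_pos_of_mulVec_eq star_mul_self_quaternion Quaternion.ofComplex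
      (fun z => by ext <;> simp) hA hv h
  · intro A l v hl hv h
    obtain ⟨μ, ⟨w, hw, hAw⟩, hμ⟩ := exists_eigenvector_re_nonpos Quaternion.ofComplex A hl hv h
    exact ⟨μ, ⟨w, hw, hAw⟩, hμ⟩

/-- There is no embedding of `ℂ` in `ℝ`, so the eigenvector statements are applied to the
complexified matrix; congruence to `1` passes to it from the real matrix. -/
theorem smallRotations_real (n : ℕ) :
    smallRotations eigenvaluesReal = positiveUnitary ℝ n := by
  have hF : ∀ x : ℂ, star x * x = algebraMap ℝ ℂ (‖x‖ ^ 2) := fun x => by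
    rw [Complex.star_def, Complex.conj_mul']; simp
  have hR : ∀ x : ℝ, star x * x = algebraMap ℝ ℝ (‖x‖ ^ 2) := fun x => by simp [sq]
  let c : Matrix (Fin n) (Fin n) ℝ →+* Matrix (Fin n) (Fin n) ℂ := Complex.ofRealHom.mapMatrix
  have hcs : ∀ A, c (star A) = star (c A) := fun A => by
    ext i j
    simp [c, Matrix.star_apply]
  have hv0 : ∀ v : Fin n → ℝ, v ≠ 0 → (fun i => (v i : ℂ)) ≠ 0 := by
    intro v hv h
    apply hv
    funext i
    exact Complex.ofReal_eq_zero.1 (congrFun h i)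
  have hcv : ∀ A (v : Fin n → ℝ), c A *ᵥ (fun i => (v i : ℂ)) = fun i => ((A *ᵥ v) i : ℂ) := by
    intro A v
    funext i
    exact (RingHom.map_mulVec Complex.ofRealHom A v i).symm
  refine smallRotations_eq_positiveUnitary hR _ ?_ ?_
  · rintro A hA μ ⟨v, hv, h⟩
    have hcA : IsCongruentToOne (hermitianPart (c A)) := by
      obtain ⟨r, hr, h⟩ := hA
      refine ⟨c r, hr.map c, ?_⟩
      have : hermitianPart (c A) = c (hermitianPart A) := by
        ext i j
        simp [hermitianPart, c, Matrix.star_apply]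
      rw [this, ← hcs, ← map_mul, ← map_mul, h, map_one]
    refine re_pos_of_mulVec_eq hF (AlgHom.id ℝ ℂ) (fun _ => rfl) hcA hv (h.trans ?_)
    funext k
    simp [mul_comm]
  · intro A l v hl hv h
    obtain ⟨μ, ⟨w, hw, hAw⟩, hμ⟩ :=
      exists_eigenvector_re_nonpos (AlgHom.id ℝ ℂ) (c A) hl (hv0 v hv) (by
        rw [hcv, hcv]
        funext i
        have := congrFun h i
        simp only [Pi.add_apply, Pi.smul_apply, smul_eq_mul] at this ⊢
        rw [← Complex.ofReal_add, this]
        simp)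
    refine ⟨μ, ⟨w, hw, hAw.trans ?_⟩, hμ⟩
    funext k
    simp [mul_comm]

end Instances

/-! ### The complexified groups as classical groups -/

section ClassicalGroups

variable {F : Type*} [NormedDivisionRing F] [StarRing F] {n : ℕ}

/-- An isomorphism of a complexified matrix algebra with a topological ring restricts to the
unitary group. -/
def unitaryGpCEquiv {R : Type*} [Monoid R] [TopologicalSpace R] (T : Submonoid R)
    (κ : Complexified (Matrix (Fin n) (Fin n) F) ≃* R) (hκ : Continuous κ)
    (hκ' : Continuous κ.symm) (hT : ∀ g, κ g ∈ T ↔ κ (star g) * κ g = 1) :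
    UnitaryGpC F n ≃ₜ* T where
  toFun g := ⟨κ g.1, (hT _).2 (by rw [← map_mul, (Unitary.mem_iff.1 g.2).1, map_one])⟩
  invFun h := ⟨κ.symm h.1, mem_unitaryGpC_of_star_mul_self (κ.injective (by
    rw [map_mul, map_one, ← hT, κ.apply_symm_apply]; exact h.2))⟩
  left_inv g := Subtype.ext (κ.symm_apply_apply _)
  right_inv h := Subtype.ext (κ.apply_symm_apply _)
  map_mul' g h := Subtype.ext (map_mul κ _ _)
  continuous_toFun := (hκ.comp continuous_subtype_val).subtype_mk _
  continuous_invFun := (hκ'.comp continuous_subtype_val).subtype_mk _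

/-- The complexification of the real matrices is the algebra of complex matrices. -/
def realToClassicalEquiv (n : ℕ) :
    Complexified (Matrix (Fin n) (Fin n) ℝ) ≃* Matrix (Fin n) (Fin n) ℂ where
  toFun := realToClassical
  invFun h := ⟨h.map Complex.re, h.map Complex.im⟩
  left_inv g := by
    ext i j <;> simp [realToClassical]
  right_inv h := by
    ext i j
    apply Complex.ext <;> simp [realToClassical]
  map_mul' g h := by
    have hm : ∀ a b : Matrix (Fin n) (Fin n) ℝ, (a * b).map (fun r : ℝ => (r : ℂ)) =
        a.map (fun r : ℝ => (r : ℂ)) * b.map (fun r : ℝ => (r : ℂ)) :=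
      fun a b => map_mul (Complex.ofRealHom.mapMatrix) a b
    have ha : ∀ a b : Matrix (Fin n) (Fin n) ℝ, (a + b).map (fun r : ℝ => (r : ℂ)) =
        a.map (fun r : ℝ => (r : ℂ)) + b.map (fun r : ℝ => (r : ℂ)) :=
      fun a b => map_add (Complex.ofRealHom.mapMatrix) a b
    have hs : ∀ a b : Matrix (Fin n) (Fin n) ℝ, (a - b).map (fun r : ℝ => (r : ℂ)) =
        a.map (fun r : ℝ => (r : ℂ)) - b.map (fun r : ℝ => (r : ℂ)) :=
      fun a b => map_sub (Complex.ofRealHom.mapMatrix) a b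
    simp only [realToClassical, Complexified.mul_re, Complexified.mul_im, hm, ha, hs, add_mul,
      mul_add, smul_mul_assoc, mul_smul_comm, smul_add, smul_smul, Complex.I_mul_I, neg_smul,
      one_smul]
    abel

theorem exists_orthogonal_equiv (n : ℕ) :
    ∃ e : UnitaryGpC ℝ n ≃ₜ* Matrix.orthogonalGroup (Fin n) ℂ,
      ∀ g, (e g : Matrix (Fin n) (Fin n) ℂ) = realToClassical g.1 := by
  refine ⟨unitaryGpCEquiv _ (realToClassicalEquiv n) ?_ ?_ ?_, fun g => rfl⟩
  · exact (continuous_complexified_re.matrix_map Complex.continuous_ofReal).add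
      ((continuous_complexified_im.matrix_map Complex.continuous_ofReal).const_smul Complex.I)
  · exact continuous_complexified_mk (continuous_id.matrix_map Complex.continuous_re)
      (continuous_id.matrix_map Complex.continuous_im)
  · intro g
    have : realToClassicalEquiv n (star g) = (realToClassicalEquiv n g)ᵀ := by
      ext i j
      simp [realToClassicalEquiv, realToClassical, Matrix.star_apply]
    rw [this]
    exact Matrix.mem_orthogonalGroup_iff' _ _

theorem complexToClassical_one : complexToClassical (n := n) 1 = 1 := by
  simp [complexToClassical]

theorem complexToClassical_mul (z w : Complexified (Matrix (Fin n) (Fin n) ℂ)) :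
    complexToClassical (z * w) = complexToClassical z * complexToClassical w := by
  simp only [complexToClassical, Complexified.mul_re, Complexified.mul_im, add_mul,
    mul_add, smul_mul_assoc, mul_smul_comm, smul_add, smul_smul, Complex.I_mul_I, neg_smul,
    one_smul]
  abel

/-- Evaluation alone is not injective, but `g ↦ (a + ib, a* + ib*)` is: the adjoint of the second
entry is `a - ib`. In these coordinates `g*g = gg* = 1` says that the two entries are mutually
inverse. -/
theorem complexToClassical_ext {z w : Complexified (Matrix (Fin n) (Fin n) ℂ)}
    (h : complexToClassical z = complexToClassical w)
    (h' : complexToClassical (star z) = complexToClassical (star w)) : z = w := by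
  have h2 := congrArg star h'
  simp only [complexToClassical, Complexified.star_re, Complexified.star_im, star_add, star_smul,
    star_star, Complex.star_def, Complex.conj_I, neg_smul] at h h2
  have hre : z.re = w.re := by
    have h3 : (2 : ℂ) • z.re = (2 : ℂ) • w.re := by
      rw [two_smul, two_smul]
      calc z.re + z.re = (z.re + Complex.I • z.im) + (z.re + -(Complex.I • z.im)) := by abel
        _ = _ := by rw [h, h2]; abel
    exact smul_right_injective _ two_ne_zero h3
  rw [hre] at h
  exact Complexified.ext hre (smul_right_injective _ Complex.I_ne_zero (add_left_cancel h))

/-- The element of the complexification with given values under `complexToClassical` and its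
composition with the involution. -/
def complexFromClassical (h k : Matrix (Fin n) (Fin n) ℂ) :
    Complexified (Matrix (Fin n) (Fin n) ℂ) :=
  ⟨(2⁻¹ : ℂ) • (h + star k), (-(Complex.I * 2⁻¹)) • (h - star k)⟩

theorem complexToClassical_complexFromClassical (h k : Matrix (Fin n) (Fin n) ℂ) :
    complexToClassical (complexFromClassical h k) = h := by
  simp only [complexToClassical, complexFromClassical, smul_smul]
  have : Complex.I * -(Complex.I * 2⁻¹) = 2⁻¹ := by
    linear_combination (-2⁻¹) * Complex.I_mul_I
  rw [this, ← smul_add, add_add_sub_cancel, ← two_smul ℂ, smul_smul]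
  norm_num

theorem complexToClassical_star_complexFromClassical (h k : Matrix (Fin n) (Fin n) ℂ) :
    complexToClassical (star (complexFromClassical h k)) = k := by
  have : star (complexFromClassical h k) = complexFromClassical k h := by
    have h2 : star (2⁻¹ : ℂ) = 2⁻¹ := by simp
    ext1
    · simp only [complexFromClassical, Complexified.star_re, star_smul, star_add, star_star, h2]
      rw [add_comm]
    · simp only [complexFromClassical, Complexified.star_im, star_smul, star_sub, star_star,
        star_neg, star_mul, h2, Complex.star_def, Complex.conj_I]
      rw [← neg_sub k, smul_neg, ← neg_smul]
      congr 1
      ring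
  rw [this, complexToClassical_complexFromClassical]

theorem exists_generalLinear_equiv (n : ℕ) :
    ∃ e : UnitaryGpC ℂ n ≃ₜ* Matrix.GeneralLinearGroup (Fin n) ℂ,
      ∀ g, (e g : Matrix (Fin n) (Fin n) ℂ) = complexToClassical g.1 := by
  have hc : Continuous (complexToClassical (n := n)) :=
    continuous_complexified_re.add (continuous_complexified_im.const_smul Complex.I)
  have hstar : Continuous fun g : UnitaryGpC ℂ n => star g.1 :=
    continuous_complexified_mk
      (continuous_star.comp (continuous_complexified_re.comp continuous_subtype_val))
      (continuous_star.comp (continuous_complexified_im.comp continuous_subtype_val))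
  have hmem : ∀ u : Matrix.GeneralLinearGroup (Fin n) ℂ,
      complexFromClassical u.1 u⁻¹.1 ∈ UnitaryGpC ℂ n := by
    intro u
    refine mem_unitaryGpC_of_star_mul_self (complexToClassical_ext ?_ ?_)
    · rw [complexToClassical_mul, complexToClassical_complexFromClassical,
        complexToClassical_star_complexFromClassical, complexToClassical_one]
      exact u.inv_mul
    · rw [star_mul, star_star, complexToClassical_mul, complexToClassical_complexFromClassical,
        complexToClassical_star_complexFromClassical, star_one, complexToClassical_one]
      exact u.inv_mul
  let f : UnitaryGpC ℂ n → Matrix.GeneralLinearGroup (Fin n) ℂ := fun g =>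
    ⟨complexToClassical g.1, complexToClassical (star g.1),
      by rw [← complexToClassical_mul, (Unitary.mem_iff.1 g.2).2, complexToClassical_one],
      by rw [← complexToClassical_mul, (Unitary.mem_iff.1 g.2).1, complexToClassical_one]⟩
  refine ⟨{
    toFun := f
    invFun := fun u => ⟨complexFromClassical u.1 u⁻¹.1, hmem u⟩
    left_inv := fun g => Subtype.ext (complexToClassical_ext
      (complexToClassical_complexFromClassical _ _)
      (complexToClassical_star_complexFromClassical _ _))
    right_inv := fun u => Units.ext (complexToClassical_complexFromClassical _ _)
    map_mul' := fun g h => Units.ext (complexToClassical_mul _ _)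
    continuous_toFun := Units.continuous_iff.2
      ⟨hc.comp continuous_subtype_val, hc.comp hstar⟩
    continuous_invFun := ?_ }, fun g => rfl⟩
  have h1 : Continuous fun u : Matrix.GeneralLinearGroup (Fin n) ℂ => u.1 := Units.continuous_val
  have h2 : Continuous fun u : Matrix.GeneralLinearGroup (Fin n) ℂ => star (u⁻¹).1 :=
    continuous_star.comp (Units.continuous_val.comp continuous_inv)
  exact (continuous_complexified_mk ((h1.add h2).const_smul (2⁻¹ : ℂ))
    ((h1.sub h2).const_smul (-(Complex.I * 2⁻¹)))).subtype_mk _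

/-- The first complex coordinate `z` of the quaternion `z + w j`. -/
def quaternionFst : ℍ →+ ℂ where
  toFun q := ⟨q.re, q.imI⟩
  map_zero' := rfl
  map_add' _ _ := rfl

/-- The second complex coordinate `w` of the quaternion `z + w j`. -/
def quaternionSnd : ℍ →+ ℂ where
  toFun q := ⟨q.imJ, q.imK⟩
  map_zero' := rfl
  map_add' _ _ := rfl

theorem quaternionFst_apply (q : ℍ) : quaternionFst q = ⟨q.re, q.imI⟩ := rfl

theorem quaternionSnd_apply (q : ℍ) : quaternionSnd q = ⟨q.imJ, q.imK⟩ := rfl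

/-- This and the next formula come from `j z = conj z j` and `j² = -1`. -/
theorem quaternionFst_mul (p q : ℍ) : quaternionFst (p * q) =
    quaternionFst p * quaternionFst q - quaternionSnd p * star (quaternionSnd q) := by
  apply Complex.ext <;> simp [quaternionFst_apply, quaternionSnd_apply] <;> ring

theorem quaternionSnd_mul (p q : ℍ) : quaternionSnd (p * q) =
    quaternionFst p * quaternionSnd q + quaternionSnd p * star (quaternionFst q) := by
  apply Complex.ext <;> simp [quaternionFst_apply, quaternionSnd_apply] <;> ring

theorem quaternionEmbedding_eq (a : Matrix (Fin n) (Fin n) ℍ) :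
    quaternionEmbedding a = Matrix.fromBlocks (a.map quaternionFst) (a.map quaternionSnd)
      (a.map fun q => -star (quaternionSnd q)) (a.map fun q => star (quaternionFst q)) := rfl

theorem quaternionEmbedding_mul (a b : Matrix (Fin n) (Fin n) ℍ) :
    quaternionEmbedding (a * b) = quaternionEmbedding a * quaternionEmbedding b := by
  simp only [quaternionEmbedding_eq, Matrix.fromBlocks_multiply]
  congr 1 <;> ext i j <;>
    simp only [Matrix.map_apply, Matrix.mul_apply, Matrix.add_apply, map_sum, star_sum,
      ← Finset.sum_add_distrib, ← Finset.sum_neg_distrib, quaternionFst_mul,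
      quaternionSnd_mul, star_add, star_sub, star_mul', star_star] <;>
    refine Finset.sum_congr rfl fun k _ => ?_ <;> ring

theorem quaternionEmbedding_add (a b : Matrix (Fin n) (Fin n) ℍ) :
    quaternionEmbedding (a + b) = quaternionEmbedding a + quaternionEmbedding b := by
  simp only [quaternionEmbedding_eq, Matrix.fromBlocks_add]
  congr 1 <;> ext i j <;> simp [add_comm]

theorem quaternionEmbedding_neg (a : Matrix (Fin n) (Fin n) ℍ) :
    quaternionEmbedding (-a) = -quaternionEmbedding a := by
  simp only [quaternionEmbedding_eq, Matrix.fromBlocks_neg]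
  congr 1

/-- Written with the transpose, the adjoint involves no conjugation of complex matrices, so the
formula extends complex-linearly to the complexification. -/
theorem quaternionEmbedding_star (a : Matrix (Fin n) (Fin n) ℍ) :
    quaternionEmbedding (star a) =
      -(Matrix.J (Fin n) ℂ * (quaternionEmbedding a)ᵀ * Matrix.J (Fin n) ℂ) := by
  simp only [quaternionEmbedding_eq, Matrix.J, Matrix.fromBlocks_transpose,
    Matrix.fromBlocks_multiply, Matrix.fromBlocks_neg]
  congr 1 <;> ext i j <;> apply Complex.ext <;>
    simp [quaternionFst_apply, quaternionSnd_apply, Matrix.star_apply]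

/-- The quaternion `a + b i + c j + d k`. -/
def quaternionMk (a b c d : ℝ) : ℍ := ⟨a, b, c, d⟩

@[simp] theorem quaternionMk_re (a b c d : ℝ) : (quaternionMk a b c d).re = a := rfl
@[simp] theorem quaternionMk_imI (a b c d : ℝ) : (quaternionMk a b c d).imI = b := rfl
@[simp] theorem quaternionMk_imJ (a b c d : ℝ) : (quaternionMk a b c d).imJ = c := rfl
@[simp] theorem quaternionMk_imK (a b c d : ℝ) : (quaternionMk a b c d).imK = d := rfl

theorem continuous_quaternion_mk {X : Type*} [TopologicalSpace X] {a b c d : X → ℝ}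
    (ha : Continuous a) (hb : Continuous b) (hc : Continuous c) (hd : Continuous d) :
    Continuous fun x => quaternionMk (a x) (b x) (c x) (d x) := by
  have : (fun x => quaternionMk (a x) (b x) (c x) (d x)) = fun x =>
      a x • quaternionMk 1 0 0 0 + b x • quaternionMk 0 1 0 0 +
      c x • quaternionMk 0 0 1 0 + d x • quaternionMk 0 0 0 1 := by
    funext x
    ext <;> simp
  rw [this]
  fun_prop

theorem continuous_quaternionFst : Continuous quaternionFst :=
  Complex.equivRealProdCLM.symm.continuous.comp
    (Quaternion.continuous_re.prodMk Quaternion.continuous_imI)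

theorem continuous_quaternionSnd : Continuous quaternionSnd :=
  Complex.equivRealProdCLM.symm.continuous.comp
    (Quaternion.continuous_imJ.prodMk Quaternion.continuous_imK)

theorem continuous_quaternionEmbedding : Continuous (quaternionEmbedding (n := n)) := by
  refine Continuous.matrix_fromBlocks (continuous_id.matrix_map continuous_quaternionFst)
    (continuous_id.matrix_map continuous_quaternionSnd)
    (continuous_id.matrix_map (f := fun q => -star (quaternionSnd q)) ?_)
    (continuous_id.matrix_map (f := fun q => star (quaternionFst q)) ?_)
  · exact (continuous_star.comp continuous_quaternionSnd).neg
  · exact continuous_star.comp continuous_quaternionFst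

/-- The complexification of the quaternionic matrices is an algebra of complex matrices. -/
def quaternionToClassicalEquiv (n : ℕ) :
    Complexified (Matrix (Fin n) (Fin n) ℍ) ≃* Matrix (Fin n ⊕ Fin n) (Fin n ⊕ Fin n) ℂ where
  toFun := quaternionToClassical
  -- For `a = a₀ + a₁i + a₂j + a₃k` and `b` likewise, the entries of the blocks are `(a₀ - b₁) +
  -- i(a₁ + b₀)`, `(a₂ - b₃) + i(a₃ + b₂)` in the top row and `(-a₂ - b₃) + i(a₃ - b₂)`, `(a₀ + b₁)
  -- + i(b₀ - a₁)` below; these are solved for the coefficients.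
  invFun h :=
    ⟨Matrix.of fun i j =>
      quaternionMk (((h (.inl i) (.inl j)).re + (h (.inr i) (.inr j)).re) / 2)
        (((h (.inl i) (.inl j)).im - (h (.inr i) (.inr j)).im) / 2)
        (((h (.inl i) (.inr j)).re - (h (.inr i) (.inl j)).re) / 2)
        (((h (.inl i) (.inr j)).im + (h (.inr i) (.inl j)).im) / 2),
    Matrix.of fun i j =>
      quaternionMk (((h (.inl i) (.inl j)).im + (h (.inr i) (.inr j)).im) / 2)
        (((h (.inr i) (.inr j)).re - (h (.inl i) (.inl j)).re) / 2)
        (((h (.inl i) (.inr j)).im - (h (.inr i) (.inl j)).im) / 2)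
        (-((h (.inl i) (.inr j)).re + (h (.inr i) (.inl j)).re) / 2)⟩
  left_inv g := by
    ext i j <;> simp [quaternionToClassical, quaternionEmbedding] <;> ring
  right_inv h := by
    ext (i | i) (j | j) <;> apply Complex.ext <;>
      simp [quaternionToClassical, quaternionEmbedding] <;> ring
  map_mul' g h := by
    simp only [quaternionToClassical, Complexified.mul_re, Complexified.mul_im, sub_eq_add_neg,
      quaternionEmbedding_add, quaternionEmbedding_neg, quaternionEmbedding_mul, add_mul,
      mul_add, smul_mul_assoc, mul_smul_comm, smul_add, smul_smul, Complex.I_mul_I, neg_smul,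
      one_smul]
    abel

theorem exists_symplectic_equiv (n : ℕ) :
    ∃ e : UnitaryGpC ℍ n ≃ₜ* Matrix.symplecticGroup (Fin n) ℂ,
      ∀ g, (e g : Matrix (Fin n ⊕ Fin n) (Fin n ⊕ Fin n) ℂ) = quaternionToClassical g.1 := by
  refine ⟨unitaryGpCEquiv _ (quaternionToClassicalEquiv n) ?_ ?_ ?_, fun g => rfl⟩
  · exact (continuous_quaternionEmbedding.comp continuous_complexified_re).add
      ((continuous_quaternionEmbedding.comp continuous_complexified_im).const_smul Complex.I)
  · refine continuous_complexified_mk ?_ ?_ <;>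
      refine continuous_matrix fun i j => ?_ <;>
      refine continuous_quaternion_mk ?_ ?_ ?_ ?_ <;> fun_prop
  · intro g
    have hs : quaternionToClassicalEquiv n (star g) = -(Matrix.J (Fin n) ℂ *
        (quaternionToClassicalEquiv n g)ᵀ * Matrix.J (Fin n) ℂ) := by
      change quaternionToClassical (star g) = -(_ * (quaternionToClassical g)ᵀ * _)
      simp only [quaternionToClassical, Complexified.star_re, Complexified.star_im,
        quaternionEmbedding_star, Matrix.transpose_add, Matrix.transpose_smul, mul_add, add_mul,
        mul_smul_comm, smul_mul_assoc, smul_neg, neg_add]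
    -- As `J² = -1`, multiplication by `J` on the left converts between `-J hᵀ J h = 1` and `hᵀ J h
    -- = J`.
    have hJ : Matrix.J (Fin n) ℂ * Matrix.J (Fin n) ℂ = -1 := Matrix.J_squared _ _
    rw [hs, SymplecticGroup.mem_iff']
    generalize quaternionToClassicalEquiv n g = h
    constructor
    · intro hh
      calc _ = -(Matrix.J (Fin n) ℂ * (hᵀ * Matrix.J (Fin n) ℂ * h)) := by
            simp only [neg_mul, mul_assoc]
        _ = 1 := by rw [hh, hJ, neg_neg]
    · intro hh
      calc hᵀ * Matrix.J (Fin n) ℂ * h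
          = -(Matrix.J (Fin n) ℂ * Matrix.J (Fin n) ℂ) * (hᵀ * Matrix.J (Fin n) ℂ * h) := by
            rw [hJ, neg_neg, one_mul]
        _ = Matrix.J (Fin n) ℂ * (-(Matrix.J (Fin n) ℂ * hᵀ * Matrix.J (Fin n) ℂ) * h) := by
            simp only [neg_mul, mul_neg, mul_assoc]
        _ = _ := by rw [hh, mul_one]

end ClassicalGroups

/-! ### Conclusion -/

theorem naturallyIdentified_real (n : ℕ) :
    NaturallyIdentified ℝ n (smallRotations eigenvaluesReal) := by
  rw [smallRotations_real]
  exact naturallyIdentified_positiveUnitary fun x => by simp [sq]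

theorem naturallyIdentified_complex (n : ℕ) :
    NaturallyIdentified ℂ n (smallRotations eigenvaluesComplex) := by
  rw [smallRotations_complex]
  exact naturallyIdentified_positiveUnitary fun x => by
    rw [Complex.star_def, Complex.conj_mul']; simp

theorem naturallyIdentified_quaternion (n : ℕ) :
    NaturallyIdentified ℍ n (smallRotations eigenvaluesQuaternion) := by
  rw [smallRotations_quaternion]
  exact naturallyIdentified_positiveUnitary star_mul_self_quaternion

end

theorem proposition4p1 (n : ℕ) :
    -- the identification, for the real numbers, the complex numbers and the quaternions
    (NaturallyIdentified ℝ n (smallRotations eigenvaluesReal) ∧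
      NaturallyIdentified ℂ n (smallRotations eigenvaluesComplex) ∧
      NaturallyIdentified ℍ n (smallRotations eigenvaluesQuaternion)) ∧
    -- the three complexified groups are the orthogonal, general linear and symplectic groups
    (∃ e : UnitaryGpC ℝ n ≃ₜ* Matrix.orthogonalGroup (Fin n) ℂ,
      ∀ g, (e g : Matrix (Fin n) (Fin n) ℂ) = realToClassical g.1) ∧
    (∃ e : UnitaryGpC ℂ n ≃ₜ* Matrix.GeneralLinearGroup (Fin n) ℂ,
      ∀ g, (e g : Matrix (Fin n) (Fin n) ℂ) = complexToClassical g.1) ∧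
    (∃ e : UnitaryGpC ℍ n ≃ₜ* Matrix.symplecticGroup (Fin n) ℂ,
      ∀ g, (e g : Matrix (Fin n ⊕ Fin n) (Fin n ⊕ Fin n) ℂ) = quaternionToClassical g.1) := by
  exact ⟨⟨naturallyIdentified_real n, naturallyIdentified_complex n,
    naturallyIdentified_quaternion n⟩, exists_orthogonal_equiv n, exists_generalLinear_equiv n,
    exists_symplectic_equiv n⟩
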